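/- Theorem 9.6 (projective Knörrer map). Let $b_0<0<b_1<\dots<b_n$ be real numbers, let $B=\mathrm{diag}(b_0,\dots,b_n)$, and write $(\cdot,\cdot)$, $|\cdot|$ for the Euclidean inner product and norm on $\mathbb R^{n+1}$. Let $$\mathcal H=\{[\xi_0:\dots:\xi_{n+1}]\in\mathbb{RP}^{n+1}:\ b_0\xi_0^2+\dots+b_n\xi_n^2=\xi_{n+1}^2\}$$ be the projective closure of the hyperboloid $(Bx,x)=1$ in $\mathbb R^{n+1}$, where $x_k=\xi_k/\xi_{n+1}$. Equip $\mathcal H$ with the pseudo-Riemannian metric which on the hyperboloid is the restriction of $ds_1^2=(B\,dx,dx)/|Bx|^2$, extended by continuity to the points at infinity; in homogeneous coordinates it is $$\frac{b_0\,d\xi_0^2+\dots+b_n\,d\xi_n^2-d\xi_{n+1}^2}{b_0^2\xi_0^2+\dots+b_n^2\xi_n^2}$$ restricted to $\mathcal H$. (1) There is exactly one continuous map $\nu:\mathcal H\to\mathbb{RP}^n$ with $\nu([x:1])=[Bx]$ for all $x\in\mathbb R^{n+1}$ with $(Bx,x)=1$. (2) The map $\nu$ sends the non-isotropic geodesics of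 $\mathcal H$, in their natural parameter, to solutions of the Neumann system on $\mathbb{RP}^n=S^n/\pm$ satisfying $\Psi_0^\varepsilon(p,q)=0$. Precisely: let $J\subseteq\mathbb R$ be an open interval and $c:J\to\mathcal H$ an affinely parametrized geodesic whose velocity is non-isotropic at some point of $J$. Then there are $\varepsilon\in\{1,-1\}$ and $k>0$ such that the scalar square of $\dot c$ in this metric is equal to $\varepsilon k^2$ on all of $J$, and, with the natural parameter $\tau=kt$, there is a solution $(q(\tau),p(\tau))$, $\tau\in kJ$, of the Neumann system on the unit sphere $S^n$ with the Hamiltonian $\frac12|p|^2+\frac12\varepsilon(Bq,q)$, that is, $$|q|=1,\qquad \dot q=p,\qquad \dot p=-\varepsilon Bq+\bigl(\varepsilon(Bq,q)-|p|^2\bigr)q,$$ such that $\nu(c(\tau/k))=[q(\tau)]$ and $\Psi^\varepsilon_0(p(\tau),q(\tau))=0$ for all $\tau\in kJ$. Here $$\Psi^\varepsilon_u(p,q)=\bigl(1+(R_up,p)\bigr)(R_uq,q)-(R_up,q)^2,\qquad R_u=(uI-\varepsilon B)^{-1}.$$ -/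

import Mathlib

open Filter Topology
open scoped ContDiff

namespace Knorrer

noncomputable section

/-- The quotient topology on the projective space of a real topological vector space. -/
instance projectivizationTopology (V : Type*) [AddCommGroup V] [Module ℝ V]
    [TopologicalSpace V] : TopologicalSpace (Projectivization ℝ V) :=
  inferInstanceAs (TopologicalSpace (Quotient (projectivizationSetoid ℝ V)))

/-- The vector `v` is a vector of homogeneous coordinates of the point `P`, i.e. `v ≠ 0` and
`P = [v]`. -/
def Represents {V : Type*} [AddCommGroup V] [Module ℝ V]
    (P : Projectivization ℝ V) (v : V) : Prop :=
  ∃ hv : v ≠ 0, P = Projectivization.mk ℝ v hv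

/-- `ℝ^{n+1}`, with coordinates indexed by `0, …, n`. -/
abbrev Vec (n : ℕ) : Type := Fin (n + 1) → ℝ

/-- `ℝ^{n+2} = ℝ^{n+1} × ℝ`; the vector `ξ` has the coordinates `ξ.1 0, …, ξ.1 n` and the last
coordinate `ξ_{n+1} = ξ.2`. -/
abbrev HVec (n : ℕ) : Type := Vec n × ℝ

/-- `ℝP^n`. -/
abbrev RP (n : ℕ) : Type := Projectivization ℝ (Vec n)

/-- `ℝP^{n+1}`. -/
abbrev RPAmbient (n : ℕ) : Type := Projectivization ℝ (HVec n)

variable {n : ℕ}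

/-- `B x` for the matrix `B = diag (b₀, …, bₙ)`. -/
def mulB (b x : Vec n) : Vec n := fun i => b i * x i

/-- The bilinear form `(B x, y) = ∑ bᵢ xᵢ yᵢ`. -/
def formB (b x y : Vec n) : ℝ := ∑ i, b i * x i * y i

/-- `|x|²`, the square of the Euclidean norm. -/
def normSq (x : Vec n) : ℝ := ∑ i, x i ^ 2

/-! ### The projective quadric and the metric -/

/-- The projective quadric `b₀ ξ₀² + ⋯ + bₙ ξₙ² = ξₙ₊₁²` in `ℝP^{n+1}`: the projective closure of
the hyperboloid `(B x, x) = 1`, whose points `x` are the points `[x : 1]`. -/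
def quadric (b : Vec n) : Set (RPAmbient n) :=
  {P | ∀ ξ : HVec n, Represents P ξ → formB b ξ.1 ξ.1 = ξ.2 ^ 2}

/-- The metric `ds₁² = (B dx, dx) / |B x|²` in the affine coordinates, as a bilinear form in
the tangent vectors `v`, `w` at `x`. -/
def affineMetric (b x v w : Vec n) : ℝ := formB b v w / normSq (mulB b x)

/-- The metric on the projective quadric, in homogeneous coordinates: a tangent vector at `[ξ]` is
given by the velocity `η` of a lift to the cone over the quadric, and the metric is
`(b₀ dξ₀² + ⋯ + bₙ dξₙ² - dξₙ₊₁²) / (b₀² ξ₀² + ⋯ + bₙ² ξₙ²)`. The denominator does not vanish on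
the cone outside the origin. On the affine part this is the restriction of `ds₁²`
(`quadricMetric_eq_affineMetric`), so it is the extension of that restriction by
continuity to the points at infinity. -/
def quadricMetric (b : Vec n) (ξ η ζ : HVec n) : ℝ :=
  (formB b η.1 ζ.1 - η.2 * ζ.2) / normSq (mulB b ξ.1)

/-- The differential at `ξ`, in the direction `η`, of the passage `ξ ↦ ξ' / ξₙ₊₁` to the
affine coordinates. -/
def affineVelocity (ξ η : HVec n) : Vec n :=
  fun i => (η.1 i * ξ.2 - ξ.1 i * η.2) / ξ.2 ^ 2

/-- On the affine part of the quadric, `quadricMetric` is the restriction of `ds₁²`. -/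
theorem quadricMetric_eq_affineMetric (b : Vec n) (ξ η ζ : HVec n) (h : ξ.2 ≠ 0)
    (hξ : formB b ξ.1 ξ.1 = ξ.2 ^ 2) (hη : formB b ξ.1 η.1 = ξ.2 * η.2)
    (hζ : formB b ξ.1 ζ.1 = ξ.2 * ζ.2) :
    quadricMetric b ξ η ζ =
      affineMetric b (fun i => ξ.1 i / ξ.2) (affineVelocity ξ η) (affineVelocity ξ ζ) := by
  have e1 : formB b (affineVelocity ξ η) (affineVelocity ξ ζ) =
      (formB b η.1 ζ.1 * ξ.2 ^ 2 - ξ.2 * ζ.2 * formB b ξ.1 η.1 - ξ.2 * η.2 * formB b ξ.1 ζ.1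
        + η.2 * ζ.2 * formB b ξ.1 ξ.1) / ξ.2 ^ 4 := by
    simp only [formB, affineVelocity, Finset.mul_sum, Finset.sum_mul, ← Finset.sum_sub_distrib,
      ← Finset.sum_add_distrib, Finset.sum_div]
    refine Finset.sum_congr rfl fun i _ => ?_
    field_simp
    ring
  have e2 : normSq (mulB b (fun i => ξ.1 i / ξ.2)) = normSq (mulB b ξ.1) / ξ.2 ^ 2 := by
    simp only [normSq, mulB, Finset.sum_div]
    refine Finset.sum_congr rfl fun i _ => ?_
    field_simp
  rw [quadricMetric, affineMetric, e1, e2, hξ, hη, hζ]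
  by_cases hN : normSq (mulB b ξ.1) = 0
  · simp [hN]
  · field_simp
    ring

/-! ### Geodesics -/

/-- A smooth local parametrization `u ↦ [φ u]` of the quadric by an open set `U ⊆ ℝⁿ`, given
by homogeneous coordinates. The last condition says that `u ↦ [φ u]` is an immersion. -/
structure IsLocalParam (b : Vec n) (U : Set (Fin n → ℝ)) (φ : (Fin n → ℝ) → HVec n) : Prop where
  isOpen : IsOpen U
  smooth : ContDiffOn ℝ ∞ φ U
  ne_zero : ∀ u ∈ U, φ u ≠ 0
  mem : ∀ u ∈ U, formB b (φ u).1 (φ u).1 = (φ u).2 ^ 2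
  immersion : ∀ u ∈ U, ∀ (v : Fin n → ℝ) (a : ℝ), fderiv ℝ φ u v = a • φ u → v = 0

/-- The partial derivative `∂ᵢ f`. -/
def partialDeriv {E : Type*} [NormedAddCommGroup E] [NormedSpace ℝ E]
    (i : Fin n) (f : (Fin n → ℝ) → E) (u : Fin n → ℝ) : E :=
  fderiv ℝ f u (Pi.single i 1)

/-- The matrix `g_{ij}` of the metric of the quadric in a local parametrization. -/
def metricMatrix (b : Vec n) (φ : (Fin n → ℝ) → HVec n) (u : Fin n → ℝ) :
    Matrix (Fin n) (Fin n) ℝ :=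
  Matrix.of fun i j => quadricMetric b (φ u) (partialDeriv i φ u) (partialDeriv j φ u)

/-- The Christoffel symbols
`Γⁱ_{jk} = ½ g^{im} (∂_j g_{mk} + ∂_k g_{mj} - ∂_m g_{jk})` of a metric `g_{ij}`. -/
def christoffel (g : (Fin n → ℝ) → Matrix (Fin n) (Fin n) ℝ) (u : Fin n → ℝ)
    (i j k : Fin n) : ℝ :=
  1 / 2 * ∑ m, (g u)⁻¹ i m *
    (partialDeriv j (fun y => g y m k) u + partialDeriv k (fun y => g y m j) u
      - partialDeriv m (fun y => g y j k) u)

/-- The curve `c`, on the open set `J` of times, is an (affinely parametrized) geodesic of the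
quadric: near every time of `J` it can be written in a local parametrization as `[φ (u t)]` with
`üⁱ + Γⁱ_{jk} u̇ʲ u̇ᵏ = 0`. Here `w` is the velocity `u̇`. -/
def IsGeodesic (b : Vec n) (J : Set ℝ) (c : ℝ → quadric b) : Prop :=
  ∀ t₀ ∈ J, ∃ (U : Set (Fin n → ℝ)) (φ : (Fin n → ℝ) → HVec n) (u w : ℝ → Fin n → ℝ),
    IsLocalParam b U φ ∧
    ∀ᶠ t in 𝓝 t₀, u t ∈ U ∧ Represents (c t : RPAmbient n) (φ (u t)) ∧
      HasDerivAt u (w t) t ∧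
      HasDerivAt w
        (fun i => -∑ j, ∑ k, christoffel (metricMatrix b φ) (u t) i j k * w t j * w t k) t

/-- The curve `c` on the quadric is differentiable at `t₀` and its velocity there has the scalar
square `κ` in the metric of the quadric. This does not depend on the choice of the lift `ξ`. -/
def HasSqSpeedAt (b : Vec n) (c : ℝ → quadric b) (t₀ κ : ℝ) : Prop :=
  ∃ (ξ : ℝ → HVec n) (η : HVec n),
    (∀ᶠ t in 𝓝 t₀, Represents (c t : RPAmbient n) (ξ t)) ∧ HasDerivAt ξ η t₀ ∧
      quadricMetric b (ξ t₀) η η = κ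

/-- The velocity of `c` is non-isotropic at some time of `J`. (On a connected `J`, the scalar
square of the velocity of a geodesic is constant.) -/
def IsNonIsotropic (b : Vec n) (J : Set ℝ) (c : ℝ → quadric b) : Prop :=
  ∃ t ∈ J, ∃ κ : ℝ, κ ≠ 0 ∧ HasSqSpeedAt b c t κ

/-! ### The projective Knörrer map and the Neumann system -/

/-- `ν` is the projective Knörrer map: it is given by `ν(x) = [B x]` at the points `[x : 1]` of
the affine part of the quadric, and it is continuous on the whole projective quadric. -/
def IsKnorrerMap (b : Vec n) (ν : quadric b → RP n) : Prop :=
  Continuous ν ∧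
    ∀ (P : quadric b) (x : Vec n), Represents (P : RPAmbient n) ((x, 1) : HVec n) →
      Represents (ν P) (mulB b x)

/-- `(q, p)`, on the set `J` of times, is a solution of the Neumann system on the unit sphere with
the Hamiltonian `½ |p|² + ½ ε (B q, q)`: `q̇ = p` and `q̈ = -ε B q + μ q` on `|q|² = 1`, with the
Lagrange multiplier `μ = ε (B q, q) - (q̇, q̇)`. -/
def IsNeumannSolution (b : Vec n) (ε : ℝ) (J : Set ℝ) (q p : ℝ → Vec n) : Prop :=
  ∀ t ∈ J, normSq (q t) = 1 ∧ HasDerivAt q (p t) t ∧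
    HasDerivAt p
      (-(ε • mulB b (q t)) + (ε * formB b (q t) (q t) - normSq (p t)) • q t) t

/-- `Ψ^ε_u (p, q) = (1 + (R_u p, p)) (R_u q, q) - (R_u p, q)²` with `R_u = (u I - ε B)⁻¹`. -/
def Psi (b : Vec n) (ε u : ℝ) (p q : Vec n) : ℝ :=
  (1 + ∑ i, (u - ε * b i)⁻¹ * p i * p i) * (∑ i, (u - ε * b i)⁻¹ * q i * q i)
    - (∑ i, (u - ε * b i)⁻¹ * p i * q i) ^ 2

end

end Knorrer

/-! The map is `[ξ] ↦ [B ξ']`, where `ξ'` drops the last coordinate: on the cone `ξ' = 0` would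
force `ξ = 0`, and `B` is invertible. Continuity descends from the cone through an open quotient
map. Uniqueness holds because the affine points are dense and `ℝPⁿ` is Hausdorff.

For geodesics, let `Q = coneForm b` and `M = denForm b`, so that the metric is `Q(η, η) / M(ξ, ξ)`.
With `N = M(ξ, ξ)` and scalar square `κ`, the geodesic equation for a lift `ξ` with velocity `η` and
acceleration `ζ` says that `Q(ζ, ·) - (2 M(ξ, η) / N) Q(η, ·) + κ M(ξ, ·)` is a multiple of the
conormal `Q(ξ, ·)` (`IsLocalParam.geodesic_covector`). Its first `n + 1` coordinates give `B ζ' = (2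
M(ξ, η) / N) B η' - κ B² ξ' + l B ξ'`. Normalizing to `q = B ξ' / √N` cancels the velocity term and
leaves `q̈ = -κ B q + μ q`; the condition `|q| = 1` determines `μ`.

With `s = ξₙ₊₁ / √N`, the cone equation and its derivative give `(B⁻¹q, q) = s²`, `(B⁻¹q, q̇) = s ṡ`
and `(B⁻¹q̇, q̇) = κ + ṡ²`. Hence `((B⁻¹q̇, q̇) - κ)(B⁻¹q, q) = (B⁻¹q̇, q)²`, which becomes `Ψ₀ = 0`
after `τ = k t` (`IsGeodesicLiftAt.isNeumannLiftAt`, `exists_neumannSolution`). The local curves `q`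
are unique up to sign and glue over the interval (`exists_global_of_local`). -/

namespace Knorrer

noncomputable section

/-! ### Homogeneous coordinates and the topology of projective space. -/

section ProjectiveSpace

variable {V : Type*} [AddCommGroup V] [Module ℝ V]

theorem Represents.smul {P : Projectivization ℝ V} {v : V} (h : Represents P v) {a : ℝ}
    (ha : a ≠ 0) : Represents P (a • v) := by
  obtain ⟨hv, rfl⟩ := h
  exact ⟨smul_ne_zero ha hv, ((Projectivization.mk_eq_mk_iff' ℝ _ _ _ _).2 ⟨a, rfl⟩).symm⟩

theorem Represents.exists_smul {P : Projectivization ℝ V} {v w : V} (h : Represents P v)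
    (h' : Represents P w) : ∃ a : ℝ, a ≠ 0 ∧ w = a • v := by
  obtain ⟨hv, rfl⟩ := h
  obtain ⟨hw, e⟩ := h'
  obtain ⟨a, ha⟩ := (Projectivization.mk_eq_mk_iff' ℝ _ _ _ _).1 e.symm
  exact ⟨a, by rintro rfl; exact hw (by simpa using ha.symm), ha.symm⟩

theorem Represents.unique {P P' : Projectivization ℝ V} {v : V} (h : Represents P v)
    (h' : Represents P' v) : P = P' := by
  obtain ⟨_, rfl⟩ := h
  obtain ⟨_, rfl⟩ := h'
  rfl

theorem represents_rep (P : Projectivization ℝ V) : Represents P P.rep :=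
  ⟨P.rep_nonzero, P.mk_rep.symm⟩

variable [TopologicalSpace V]

theorem continuous_projectivization_mk :
    Continuous fun v : {v : V // v ≠ 0} => Projectivization.mk ℝ v.1 v.2 :=
  continuous_quotient_mk'

/-- The saturation of an open set is the union of its preimages under scalings by units, each of
which is open. -/
theorem isOpenMap_projectivization_mk [ContinuousConstSMul ℝ V] :
    IsOpenMap fun v : {v : V // v ≠ 0} => Projectivization.mk ℝ v.1 v.2 := by
  intro U hU
  have hq : IsQuotientMap fun v : {v : V // v ≠ 0} => Projectivization.mk ℝ v.1 v.2 :=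
    isQuotientMap_quotient_mk'
  rw [← hq.isOpen_preimage]
  have e : (fun v : {v : V // v ≠ 0} => Projectivization.mk ℝ v.1 v.2) ⁻¹'
      ((fun v : {v : V // v ≠ 0} => Projectivization.mk ℝ v.1 v.2) '' U) =
      ⋃ a : ℝˣ, (fun v : {v : V // v ≠ 0} =>
        (⟨(a : ℝ) • v.1, smul_ne_zero a.ne_zero v.2⟩ : {v : V // v ≠ 0})) ⁻¹' U := by
    ext v
    simp only [Set.mem_preimage, Set.mem_image, Set.mem_iUnion]
    constructor
    · rintro ⟨w, hw, e⟩
      obtain ⟨a, ha⟩ := (Projectivization.mk_eq_mk_iff' ℝ _ _ _ _).1 e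
      have ha0 : a ≠ 0 := by rintro rfl; exact w.2 (by simpa using ha.symm)
      refine ⟨Units.mk0 a ha0, ?_⟩
      convert hw
      exact ha
    · rintro ⟨a, ha⟩
      exact ⟨_, ha, (Projectivization.mk_eq_mk_iff' ℝ _ _ _ _).2 ⟨a, rfl⟩⟩
  rw [e]
  refine isOpen_iUnion fun a => hU.preimage ?_
  exact (continuous_subtype_val.const_smul (a : ℝ)).subtype_mk _

/-- The restriction of the projection `V ∖ 0 → ℙ(V)` to a saturated set is an open quotient map. -/
theorem isOpenQuotientMap_restrictPreimage_mk [ContinuousConstSMul ℝ V]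
    (S : Set (Projectivization ℝ V)) :
    IsOpenQuotientMap (S.restrictPreimage
      fun v : {v : V // v ≠ 0} => Projectivization.mk ℝ v.1 v.2) where
  surjective := by
    rintro ⟨P, hP⟩
    refine ⟨⟨⟨P.rep, P.rep_nonzero⟩, ?_⟩, ?_⟩
    · simpa using hP
    · ext; simp
  continuous := continuous_projectivization_mk.restrictPreimage
  isOpenMap := isOpenMap_projectivization_mk.restrictPreimage S

end ProjectiveSpace

variable {n : ℕ}

theorem normSq_nonneg (x : Vec n) : 0 ≤ normSq x := Finset.sum_nonneg fun _ _ => sq_nonneg _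

theorem normSq_eq_zero {x : Vec n} : normSq x = 0 ↔ x = 0 := by
  rw [normSq, Finset.sum_eq_zero_iff_of_nonneg fun _ _ => sq_nonneg _]
  simp [funext_iff]

theorem normSq_pos {x : Vec n} (h : x ≠ 0) : 0 < normSq x :=
  (normSq_nonneg x).lt_of_ne fun e => h (normSq_eq_zero.1 e.symm)

theorem normSq_smul (a : ℝ) (x : Vec n) : normSq (a • x) = a ^ 2 * normSq x := by
  simp [normSq, Finset.mul_sum, mul_pow]

theorem continuous_normSq : Continuous (normSq : Vec n → ℝ) := by
  unfold normSq; fun_prop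

/-- The orthogonal projection onto a line, as a matrix. -/
def lineMatrix (x : Vec n) (ij : Fin (n + 1) × Fin (n + 1)) : ℝ := x ij.1 * x ij.2 / normSq x

theorem lineMatrix_smul {a : ℝ} (ha : a ≠ 0) (x : Vec n) :
    lineMatrix (a • x) = lineMatrix x := by
  ext ij
  simp only [lineMatrix, normSq_smul, Pi.smul_apply, smul_eq_mul]
  rw [show a * x ij.1 * (a * x ij.2) = a ^ 2 * (x ij.1 * x ij.2) by ring]
  exact mul_div_mul_left _ _ (pow_ne_zero 2 ha)

/-- A line is determined by its orthogonal projection, so `lineMatrix` induces a continuous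
injection into a Euclidean space. -/
instance t2Space_RP : T2Space (RP n) := by
  have key : ∀ v w : {v : Vec n // v ≠ 0}, (projectivizationSetoid ℝ (Vec n)).r v w →
      lineMatrix v.1 = lineMatrix w.1 := by
    intro v w h
    have e : Projectivization.mk ℝ v.1 v.2 = Projectivization.mk ℝ w.1 w.2 := Quotient.sound h
    obtain ⟨a, ha⟩ := (Projectivization.mk_eq_mk_iff' ℝ _ _ _ _).1 e
    have ha0 : a ≠ 0 := by rintro rfl; exact v.2 (by simpa using ha.symm)
    rw [← ha, lineMatrix_smul ha0]
  let f : RP n → Fin (n + 1) × Fin (n + 1) → ℝ :=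
    Quotient.lift (fun v : {v : Vec n // v ≠ 0} => lineMatrix v.1) key
  refine T2Space.of_injective_continuous (f := f) ?_ ?_
  · intro P P'
    obtain ⟨v, hv, rfl⟩ : ∃ v hv, P = Projectivization.mk ℝ v hv := represents_rep P |>.elim
      fun h e => ⟨_, h, e⟩
    obtain ⟨w, hw, rfl⟩ : ∃ w hw, P' = Projectivization.mk ℝ w hw := represents_rep P' |>.elim
      fun h e => ⟨_, h, e⟩
    intro h
    change lineMatrix v = lineMatrix w at h
    rw [Projectivization.mk_eq_mk_iff']
    obtain ⟨i, hi⟩ := Function.ne_iff.1 hw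
    have hi : w i ≠ 0 := hi
    have hNv := (normSq_pos hv).ne'
    have hNw := (normSq_pos hw).ne'
    have h1 : ∀ j, v i * v j / normSq v = w i * w j / normSq w := fun j => congrFun h (i, j)
    have hvi : v i ≠ 0 := by
      intro h0
      have := h1 i
      rw [h0, zero_mul, zero_div] at this
      exact div_ne_zero (mul_ne_zero hi hi) hNw this.symm
    refine ⟨(w i * normSq v) / (v i * normSq w), ?_⟩
    ext j
    have := h1 j
    simp only [Pi.smul_apply, smul_eq_mul]
    field_simp at this ⊢
    linarith
  · refine Continuous.quotient_lift ?_ key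
    refine continuous_pi fun ij => Continuous.div ?_ ?_ ?_
    · exact ((continuous_apply _).comp continuous_subtype_val).mul
        ((continuous_apply _).comp continuous_subtype_val)
    · exact continuous_normSq.comp continuous_subtype_val
    · exact fun v => (normSq_pos v.2).ne'

/-! ### The projective Knörrer map -/

theorem mem_quadric_of_represents {b : Vec n} {P : RPAmbient n} {ξ : HVec n}
    (h : Represents P ξ) (hξ : formB b ξ.1 ξ.1 = ξ.2 ^ 2) : P ∈ quadric b := by
  intro ζ hζ
  obtain ⟨a, -, rfl⟩ := h.exists_smul hζ
  simp only [formB, Prod.smul_fst, Prod.smul_snd, Pi.smul_apply, smul_eq_mul, mul_pow, ← hξ,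
    Finset.mul_sum]
  exact Finset.sum_congr rfl fun _ _ => by ring

theorem fst_ne_zero_of_mem {b : Vec n} {ξ : HVec n} (h0 : ξ ≠ 0)
    (hξ : formB b ξ.1 ξ.1 = ξ.2 ^ 2) : ξ.1 ≠ 0 := by
  intro h
  apply h0
  rw [h] at hξ
  ext1
  · exact h
  · simpa [formB] using hξ.symm

theorem mulB_ne_zero {b x : Vec n} (hb : ∀ i, b i ≠ 0) (hx : x ≠ 0) : mulB b x ≠ 0 := by
  obtain ⟨i, hi⟩ := Function.ne_iff.1 hx
  exact Function.ne_iff.2 ⟨i, mul_ne_zero (hb i) hi⟩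

theorem mulB_smul (b : Vec n) (a : ℝ) (x : Vec n) : mulB b (a • x) = a • mulB b x := by
  ext i; simp [mulB]; ring

theorem Represents.mulB_fst_ne_zero {b : Vec n} (hb : ∀ i, b i ≠ 0) {P : RPAmbient n}
    (hP : P ∈ quadric b) {ξ : HVec n} (h : Represents P ξ) : mulB b ξ.1 ≠ 0 :=
  mulB_ne_zero hb (fst_ne_zero_of_mem h.1 (hP ξ h))

/-- The map `[ξ] ↦ [B ξ']` on the quadric. -/
def knorrerMap (b : Vec n) (hb : ∀ i, b i ≠ 0) (P : quadric b) : RP n :=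
  Projectivization.mk ℝ (mulB b P.1.rep.1) ((represents_rep P.1).mulB_fst_ne_zero hb P.2)

theorem knorrerMap_represents {b : Vec n} (hb : ∀ i, b i ≠ 0) (P : quadric b) {ξ : HVec n}
    (h : Represents P.1 ξ) : Represents (knorrerMap b hb P) (mulB b ξ.1) := by
  obtain ⟨a, ha, e⟩ := (represents_rep P.1).exists_smul h
  have : Represents (knorrerMap b hb P) (mulB b P.1.rep.1) := ⟨_, rfl⟩
  rw [e, Prod.smul_fst, mulB_smul]
  exact this.smul ha

theorem continuous_mulB (b : Vec n) : Continuous (mulB b) := by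
  unfold mulB; fun_prop

/-- Restricting a quotient map to a preimage need not give a quotient map; openness of the
projection ensures it here, so continuity may be checked on the cone. -/
theorem continuous_knorrerMap {b : Vec n} (hb : ∀ i, b i ≠ 0) : Continuous (knorrerMap b hb) := by
  rw [(isOpenQuotientMap_restrictPreimage_mk (quadric b)).isQuotientMap.continuous_iff]
  have hr : ∀ v : (fun v : {v : HVec n // v ≠ 0} => Projectivization.mk ℝ v.1 v.2) ⁻¹' quadric b,
      Represents (Projectivization.mk ℝ v.1.1 v.1.2) v.1.1 := fun v => ⟨v.1.2, rfl⟩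
  have e : knorrerMap b hb ∘ (quadric b).restrictPreimage
        (fun v : {v : HVec n // v ≠ 0} => Projectivization.mk ℝ v.1 v.2) =
      (fun x : {x : Vec n // x ≠ 0} => Projectivization.mk ℝ x.1 x.2) ∘
        fun v => ⟨mulB b v.1.1.1, (hr v).mulB_fst_ne_zero hb v.2⟩ := by
    ext1 v
    exact (knorrerMap_represents hb _ (hr v)).unique ⟨_, rfl⟩
  rw [e]
  refine continuous_projectivization_mk.comp (Continuous.subtype_mk ?_ _)
  exact (continuous_mulB b).comp (by fun_prop)

theorem isKnorrerMap_knorrerMap {b : Vec n} (hb : ∀ i, b i ≠ 0) :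
    IsKnorrerMap b (knorrerMap b hb) :=
  ⟨continuous_knorrerMap hb, fun P _ h => knorrerMap_represents hb P h⟩

/-- The affine part of the quadric. -/
def affinePart (b : Vec n) : Set (quadric b) := {P | ∃ x : Vec n, Represents P.1 ((x, 1) : HVec n)}

theorem mem_affinePart {b : Vec n} {P : quadric b} {ξ : HVec n} (h : Represents P.1 ξ)
    (h2 : ξ.2 ≠ 0) : P ∈ affinePart b := by
  refine ⟨ξ.2⁻¹ • ξ.1, ?_⟩
  have := h.smul (inv_ne_zero h2)
  rwa [show ξ.2⁻¹ • ξ = (ξ.2⁻¹ • ξ.1, 1) from Prod.ext rfl (inv_mul_cancel₀ h2)] at this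

theorem formB_self_succ (b x : Vec n) :
    formB b x x = b 0 * x 0 ^ 2 + ∑ i : Fin n, b i.succ * x i.succ ^ 2 := by
  rw [formB, Fin.sum_univ_succ]
  congr 1
  · ring
  · exact Finset.sum_congr rfl fun _ _ => by ring

/-- Every point at infinity is a limit of points of the affine part. -/
theorem dense_affinePart {b : Vec n} (hneg : b 0 < 0) (hpos : ∀ i, i ≠ 0 → 0 < b i) :
    Dense (affinePart b) := by
  rintro ⟨P, hP⟩
  obtain ⟨ξ, h0, rfl⟩ : ∃ ξ h0, P = Projectivization.mk ℝ ξ h0 := represents_rep P |>.elim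
    fun h e => ⟨_, h, e⟩
  by_cases h2 : ξ.2 ≠ 0
  · exact subset_closure (mem_affinePart ⟨h0, rfl⟩ h2)
  push Not at h2
  have hξ : formB b ξ.1 ξ.1 = ξ.2 ^ 2 := hP ξ ⟨h0, rfl⟩
  -- At infinity the last coordinate vanishes; if `ξ₀` vanished too, a sum of nonnegative terms
  -- would be zero and all coordinates would vanish.
  have h00 : ξ.1 0 ≠ 0 := by
    intro h00
    rw [formB_self_succ, h00, h2] at hξ
    simp only [ne_eq, OfNat.ofNat_ne_zero, not_false_eq_true, zero_pow, mul_zero, zero_add] at hξ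
    rw [Finset.sum_eq_zero_iff_of_nonneg fun i _ =>
      mul_nonneg (hpos _ (Fin.succ_ne_zero i)).le (sq_nonneg _)] at hξ
    refine fst_ne_zero_of_mem h0 (hP ξ ⟨h0, rfl⟩) (funext fun i => ?_)
    refine Fin.cases h00 (fun j => ?_) i
    have := hξ j (Finset.mem_univ _)
    simpa [(hpos _ (Fin.succ_ne_zero j)).ne'] using this
  -- This curve stays on the cone because `b₀ ξ₀² cos² θ - (-b₀) ξ₀² sin² θ = b₀ ξ₀²`; it leaves
  -- infinity as soon as `sin θ ≠ 0`.
  let γ : ℝ → HVec n := fun θ =>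
    (Fin.cons (ξ.1 0 * Real.cos θ) fun i => ξ.1 i.succ, Real.sqrt (-b 0) * ξ.1 0 * Real.sin θ)
  have hγξ : ∀ θ, formB b (γ θ).1 (γ θ).1 = (γ θ).2 ^ 2 := by
    intro θ
    rw [formB_self_succ, h2] at hξ
    rw [formB_self_succ]
    simp only [γ, Fin.cons_zero, Fin.cons_succ, mul_pow, Real.sq_sqrt (neg_pos.2 hneg).le]
    have := Real.sin_sq_add_cos_sq θ
    linear_combination hξ + b 0 * ξ.1 0 ^ 2 * this
  have hs : Real.sqrt (-b 0) * ξ.1 0 ≠ 0 :=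
    mul_ne_zero (Real.sqrt_pos.2 (neg_pos.2 hneg)).ne' h00
  have hγ0 : ∀ θ, γ θ ≠ 0 := by
    intro θ h
    have e1 : (γ θ).1 0 = 0 := by rw [h]; rfl
    have e2 : (γ θ).2 = 0 := by rw [h]; rfl
    have e1 : Real.cos θ = 0 := by simpa [γ, h00] using e1
    have e2 : Real.sin θ = 0 := by
      simp only [γ, mul_eq_zero] at e2
      exact e2.resolve_left (by simpa using hs)
    have := Real.sin_sq_add_cos_sq θ
    simp [e1, e2] at this
  have hγc : Continuous γ := by
    refine Continuous.prodMk (continuous_pi fun i => ?_) (by fun_prop)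
    refine Fin.cases ?_ (fun j => ?_) i
    · simp only [Fin.cons_zero]; fun_prop
    · simp only [Fin.cons_succ]; fun_prop
  let Γ : ℝ → quadric b := fun θ =>
    ⟨Projectivization.mk ℝ (γ θ) (hγ0 θ), mem_quadric_of_represents ⟨_, rfl⟩ (hγξ θ)⟩
  have hΓ : Continuous Γ :=
    (continuous_projectivization_mk.comp (hγc.subtype_mk hγ0)).subtype_mk _
  have hΓ0 : Γ 0 = ⟨Projectivization.mk ℝ ξ h0, hP⟩ := by
    have : γ 0 = ξ := by
      ext i
      · refine Fin.cases ?_ (fun j => ?_) i <;> simp [γ]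
      · simp [γ, h2]
    ext1
    simp only [Γ, this]
  have ht : Tendsto Γ (𝓝[>] 0) (𝓝 ⟨Projectivization.mk ℝ ξ h0, hP⟩) :=
    hΓ0 ▸ (hΓ.tendsto 0).mono_left nhdsWithin_le_nhds
  refine mem_closure_of_tendsto ht ?_
  filter_upwards [Ioo_mem_nhdsGT Real.pi_pos] with θ hθ
  exact mem_affinePart (ξ := γ θ) ⟨hγ0 θ, rfl⟩
    (mul_ne_zero hs (Real.sin_pos_of_mem_Ioo hθ).ne')

theorem IsKnorrerMap.eq {b : Vec n} (hneg : b 0 < 0) (hpos : ∀ i, i ≠ 0 → 0 < b i)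
    {ν ν' : quadric b → RP n} (h : IsKnorrerMap b ν) (h' : IsKnorrerMap b ν') : ν = ν' := by
  refine Continuous.ext_on (dense_affinePart hneg hpos) h.1 h'.1 ?_
  rintro P ⟨x, hx⟩
  exact (h.2 P x hx).unique (h'.2 P x hx)

/-! ### Gluing local sections that are unique up to sign. -/

section Gluing

variable {E : Type*} [NormedAddCommGroup E] [NormedSpace ℝ E]

/-- Two nowhere vanishing continuous functions on a preconnected set that agree up to sign at
each point agree up to a common sign. -/
theorem eqOn_or_eqOn_neg {I : Set ℝ} (hI : IsPreconnected I) {f g : ℝ → E}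
    (hf : ContinuousOn f I) (hg : ContinuousOn g I) (h0 : ∀ t ∈ I, f t ≠ 0)
    (h : ∀ t ∈ I, g t = f t ∨ g t = -f t) :
    (∀ t ∈ I, g t = f t) ∨ ∀ t ∈ I, g t = -f t := by
  have : IsAddTorsionFree E := .of_isTorsionFree ℝ E
  by_contra hc
  push Not at hc
  obtain ⟨⟨s, hs, hs'⟩, ⟨t, ht, ht'⟩⟩ := hc
  have hI' : PreconnectedSpace I := Subtype.preconnectedSpace hI
  have hf := hf.domRestrict
  have hg := hg.domRestrict
  obtain ⟨x, -, hx1, hx2⟩ := isPreconnected_closed_iff.1 (hI'.isPreconnected_univ)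
    {x : I | g x = f x} {x : I | g x = -f x} (isClosed_eq hg hf) (isClosed_eq hg hf.neg)
    (fun x _ => h x x.2) ⟨⟨t, ht⟩, trivial, (h t ht).resolve_right ht'⟩
    ⟨⟨s, hs⟩, trivial, (h s hs).resolve_left hs'⟩
  have hx1 : g x = f x := hx1
  have hx2 : g x = -f x := hx2
  exact h0 x x.2 (self_eq_neg.1 (hx1.symm.trans hx2))

/-- Local sections that are unique up to sign glue to a section over an interval. -/
theorem exists_global_of_local {J : Set ℝ} (hJ : IsPreconnected J)
    (G : (ℝ → E) → ℝ → Prop)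
    (hcongr : ∀ f g t, f =ᶠ[𝓝 t] g → G f t → G g t)
    (hneg : ∀ f t, G f t → G (-f) t)
    (hcont : ∀ f t, G f t → ContinuousAt f t)
    (hne : ∀ f t, G f t → f t ≠ 0)
    (huniq : ∀ f g t, G f t → G g t → g t = f t ∨ g t = -f t)
    (hloc : ∀ t ∈ J, ∃ f, ∀ᶠ s in 𝓝 t, G f s) :
    ∃ f, ∀ t ∈ J, G f t := by
  classical
  have : IsAddTorsionFree E := .of_isTorsionFree ℝ E
  rcases J.eq_empty_or_nonempty with rfl | ⟨t₀, ht₀⟩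
  · exact ⟨0, by simp⟩
  have rigid : ∀ {I : Set ℝ} {f g : ℝ → E}, IsPreconnected I → (∀ t ∈ I, G f t) →
      (∀ t ∈ I, G g t) → (∀ t ∈ I, g t = f t) ∨ ∀ t ∈ I, g t = -f t := fun hI hf hg =>
    eqOn_or_eqOn_neg hI (fun t ht => (hcont _ t (hf t ht)).continuousWithinAt)
      (fun t ht => (hcont _ t (hg t ht)).continuousWithinAt) (fun t ht => hne _ t (hf t ht))
      fun t ht => huniq _ _ t (hf t ht) (hg t ht)
  -- Being covered by one interval that carries a section is an equivalence relation that holds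
  -- locally, so connectedness of `J` extends it to all pairs.
  have hconn : ∀ x ∈ J, ∀ y ∈ J, ∃ (I : Set ℝ) (f : ℝ → E),
      IsOpen I ∧ I.OrdConnected ∧ x ∈ I ∧ y ∈ I ∧ ∀ t ∈ I, G f t := by
    intro x hx y hy
    refine hJ.induction₂ (fun x y => ∃ (I : Set ℝ) (f : ℝ → E),
      IsOpen I ∧ I.OrdConnected ∧ x ∈ I ∧ y ∈ I ∧ ∀ t ∈ I, G f t) ?_ ?_ ?_ hx hy
    · intro x hx
      obtain ⟨f, hf⟩ := hloc x hx
      obtain ⟨r, hr, hr'⟩ := Metric.eventually_nhds_iff_ball.1 hf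
      refine mem_nhdsWithin_of_mem_nhds ?_
      filter_upwards [Metric.ball_mem_nhds x hr] with y hy
      exact ⟨Metric.ball x r, f, Metric.isOpen_ball, (convex_ball x r).ordConnected,
        Metric.mem_ball_self hr, hy, hr'⟩
    · rintro x y z - - - ⟨I, f, hIo, hIc, hxI, hyI, hf⟩ ⟨K, g, hKo, hKc, hyK, hzK, hg⟩
      -- Intersections of intervals are connected, so a single change of sign makes the two sections
      -- agree on the overlap.
      obtain ⟨g', hg', hgf⟩ : ∃ g', (∀ t ∈ K, G g' t) ∧ ∀ t ∈ I ∩ K, g' t = f t := by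
        rcases rigid (I := I ∩ K) (hIc.inter hKc).isPreconnected (fun t ht => hf t ht.1)
          (fun t ht => hg t ht.2) with h | h
        · exact ⟨g, hg, h⟩
        · exact ⟨-g, fun t ht => hneg _ t (hg t ht), fun t ht => by simp [h t ht]⟩
      refine ⟨I ∪ K, fun t => if t ∈ I then f t else g' t, hIo.union hKo, ?_, Or.inl hxI,
        Or.inr hzK, ?_⟩
      · exact (IsPreconnected.union y hyI hyK hIc.isPreconnected hKc.isPreconnected).ordConnected
      · intro t ht
        by_cases htI : t ∈ I
        · refine hcongr f _ t ?_ (hf t htI)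
          filter_upwards [hIo.mem_nhds htI] with s hs
          simp [hs]
        · have htK := ht.resolve_left htI
          refine hcongr g' _ t ?_ (hg' t htK)
          filter_upwards [hKo.mem_nhds htK] with s hs
          by_cases hsI : s ∈ I
          · simp [hsI, hgf s ⟨hsI, hs⟩]
          · simp [hsI]
    · rintro x y - - ⟨I, f, h1, h2, h3, h4, h5⟩
      exact ⟨I, f, h1, h2, h4, h3, h5⟩
  obtain ⟨f₀, hf₀⟩ := hloc t₀ ht₀
  have hf₀ := hf₀.self_of_nhds
  -- Prescribing the value at `t₀` removes the sign ambiguity, so the chosen sections agree on all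
  -- overlaps.
  have hfix : ∀ y : J, ∃ (I : Set ℝ) (f : ℝ → E), IsOpen I ∧ I.OrdConnected ∧ t₀ ∈ I ∧
      (y : ℝ) ∈ I ∧ (∀ t ∈ I, G f t) ∧ f t₀ = f₀ t₀ := by
    rintro ⟨y, hy⟩
    obtain ⟨I, f, h1, h2, h3, h4, h5⟩ := hconn t₀ ht₀ y hy
    rcases huniq _ _ t₀ hf₀ (h5 t₀ h3) with h | h
    · exact ⟨I, f, h1, h2, h3, h4, h5, h⟩
    · exact ⟨I, -f, h1, h2, h3, h4, fun t ht => hneg _ t (h5 t ht), by simp [h]⟩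
  choose I f hIo hIc ht₀I hyI hf hft₀ using hfix
  have hagree : ∀ x y : J, ∀ t ∈ I x ∩ I y, f y t = f x t := by
    intro x y
    rcases rigid (I := I x ∩ I y) ((hIc x).inter (hIc y)).isPreconnected
      (fun t ht => hf x t ht.1) (fun t ht => hf y t ht.2) with h | h
    · exact h
    · have := h t₀ ⟨ht₀I x, ht₀I y⟩
      rw [hft₀, hft₀] at this
      exact absurd (self_eq_neg.1 this) (hne _ _ hf₀)
  have hJo : IsOpen (⋃ x, I x) := isOpen_iUnion hIo
  refine ⟨fun t => if h : ∃ x, t ∈ I x then f h.choose t else 0, fun t ht => ?_⟩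
  refine hcongr (f ⟨t, ht⟩) _ t ?_ (hf ⟨t, ht⟩ t (hyI ⟨t, ht⟩))
  filter_upwards [(hIo ⟨t, ht⟩).mem_nhds (hyI ⟨t, ht⟩)] with s hs
  have hex : ∃ x, s ∈ I x := ⟨_, hs⟩
  rw [dif_pos hex]
  exact hagree _ _ s ⟨hex.choose_spec, hs⟩

end Gluing

/-! ### The two quadratic forms on the cone. -/

theorem formB_add_left (b x y z : Vec n) : formB b (x + y) z = formB b x z + formB b y z := by
  simp [formB, ← Finset.sum_add_distrib, mul_add, add_mul]

theorem formB_smul_left (b : Vec n) (a : ℝ) (x y : Vec n) :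
    formB b (a • x) y = a * formB b x y := by
  simp only [formB, Finset.mul_sum, Pi.smul_apply, smul_eq_mul]
  exact Finset.sum_congr rfl fun _ _ => by ring

theorem formB_comm (b x y : Vec n) : formB b x y = formB b y x :=
  Finset.sum_congr rfl fun _ _ => by ring

theorem formB_add_right (b x y z : Vec n) : formB b x (y + z) = formB b x y + formB b x z := by
  rw [formB_comm, formB_add_left, formB_comm b y, formB_comm b z]

theorem formB_smul_right (b : Vec n) (a : ℝ) (x y : Vec n) :
    formB b x (a • y) = a * formB b x y := by
  rw [formB_comm, formB_smul_left, formB_comm]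

theorem formB_single (b x : Vec n) (i : Fin (n + 1)) :
    formB b x (Pi.single i 1) = b i * x i := by
  simp [formB, Pi.single_apply]

/-- The quadratic form `(B x, x) - s²` on `ℝ^{n+2}`, polarized. -/
def coneForm (b : Vec n) : HVec n →L[ℝ] HVec n →L[ℝ] ℝ :=
  LinearMap.toContinuousBilinearMap
    (LinearMap.mk₂ ℝ (fun η ζ : HVec n => formB b η.1 ζ.1 - η.2 * ζ.2)
      (fun η η' ζ => by simp only [Prod.fst_add, Prod.snd_add, formB_add_left]; ring)
      (fun a η ζ => by
        simp only [Prod.smul_fst, Prod.smul_snd, formB_smul_left, smul_eq_mul]; ring)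
      (fun η η' ζ => by simp only [Prod.fst_add, Prod.snd_add, formB_add_right]; ring)
      (fun a η ζ => by
        simp only [Prod.smul_fst, Prod.smul_snd, formB_smul_right, smul_eq_mul]; ring))

/-- The quadratic form `|B x|²` on `ℝ^{n+2}`, polarized. -/
def denForm (b : Vec n) : HVec n →L[ℝ] HVec n →L[ℝ] ℝ :=
  LinearMap.toContinuousBilinearMap
    (LinearMap.mk₂ ℝ (fun η ζ : HVec n => formB (fun i => b i ^ 2) η.1 ζ.1)
      (fun η η' ζ => by simp only [Prod.fst_add, formB_add_left])
      (fun a η ζ => by simp only [Prod.smul_fst, formB_smul_left, smul_eq_mul])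
      (fun η η' ζ => by simp only [Prod.fst_add, formB_add_right])
      (fun a η ζ => by simp only [Prod.smul_fst, formB_smul_right, smul_eq_mul]))

theorem coneForm_apply (b : Vec n) (η ζ : HVec n) :
    coneForm b η ζ = formB b η.1 ζ.1 - η.2 * ζ.2 := rfl

theorem denForm_apply (b : Vec n) (η ζ : HVec n) :
    denForm b η ζ = formB (fun i => b i ^ 2) η.1 ζ.1 := rfl

theorem coneForm_comm (b : Vec n) (η ζ : HVec n) : coneForm b η ζ = coneForm b ζ η := by
  rw [coneForm_apply, coneForm_apply, formB_comm, mul_comm]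

theorem denForm_comm (b : Vec n) (η ζ : HVec n) : denForm b η ζ = denForm b ζ η := by
  rw [denForm_apply, denForm_apply, formB_comm]

theorem denForm_self (b : Vec n) (ξ : HVec n) : denForm b ξ ξ = normSq (mulB b ξ.1) := by
  rw [denForm_apply]
  exact Finset.sum_congr rfl fun _ _ => by simp only [mulB]; ring

theorem quadricMetric_eq (b : Vec n) (ξ η ζ : HVec n) :
    quadricMetric b ξ η ζ = coneForm b η ζ / denForm b ξ ξ := by
  rw [denForm_self]; rfl

theorem coneForm_self_eq_zero {b : Vec n} {ξ : HVec n} :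
    coneForm b ξ ξ = 0 ↔ formB b ξ.1 ξ.1 = ξ.2 ^ 2 := by
  rw [coneForm_apply, sub_eq_zero, sq]

theorem coneForm_nondegenerate {b : Vec n} (hb : ∀ i, b i ≠ 0) {ξ : HVec n}
    (h : coneForm b ξ = 0) : ξ = 0 := by
  ext i
  · have := DFunLike.congr_fun h ((Pi.single i 1, 0) : HVec n)
    rw [coneForm_apply] at this
    simpa [formB_single, hb i] using this
  · have := DFunLike.congr_fun h ((0, 1) : HVec n)
    rw [coneForm_apply] at this
    simpa [formB] using this

theorem denForm_pos {b : Vec n} (hb : ∀ i, b i ≠ 0) {ξ : HVec n} (h0 : ξ ≠ 0)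
    (hξ : formB b ξ.1 ξ.1 = ξ.2 ^ 2) : 0 < denForm b ξ ξ := by
  rw [denForm_self]
  exact normSq_pos (mulB_ne_zero hb (fst_ne_zero_of_mem h0 hξ))

/-- The derivative is kept opaque and known only through its values, which makes later rewriting
manageable. -/
theorem exists_hasFDerivAt_bilinear {E F G : Type*} [NormedAddCommGroup E] [NormedSpace ℝ E]
    [NormedAddCommGroup F] [NormedSpace ℝ F] [NormedAddCommGroup G] [NormedSpace ℝ G]
    (B : E →L[ℝ] E →L[ℝ] G) {f g : F → E} {f' g' : F →L[ℝ] E} {x : F}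
    (hf : HasFDerivAt f f' x) (hg : HasFDerivAt g g' x) :
    ∃ D : F →L[ℝ] G, HasFDerivAt (fun y => B (f y) (g y)) D x ∧
      ∀ v, D v = B (f x) (g' v) + B (f' v) (g x) :=
  ⟨_, B.hasFDerivAt_of_bilinear hf hg, fun _ => rfl⟩

/-! ### Geometry of a local parametrization -/

namespace IsLocalParam

variable {b : Vec n} {U : Set (Fin n → ℝ)} {φ : (Fin n → ℝ) → HVec n} {u : Fin n → ℝ}

theorem contDiffAt (h : IsLocalParam b U φ) (hu : u ∈ U) : ContDiffAt ℝ ∞ φ u :=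
  h.smooth.contDiffAt (h.isOpen.mem_nhds hu)

theorem hasFDerivAt (h : IsLocalParam b U φ) (hu : u ∈ U) :
    HasFDerivAt φ (fderiv ℝ φ u) u :=
  ((h.contDiffAt hu).differentiableAt (by simp)).hasFDerivAt

theorem hasFDerivAt_fderiv (h : IsLocalParam b U φ) (hu : u ∈ U) :
    HasFDerivAt (fderiv ℝ φ) (fderiv ℝ (fderiv ℝ φ) u) u :=
  (((h.contDiffAt hu).fderiv_right (m := 1) (by norm_cast)).differentiableAt
    (by simp)).hasFDerivAt

theorem fderiv_symm (h : IsLocalParam b U φ) (hu : u ∈ U) (v w : Fin n → ℝ) :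
    fderiv ℝ (fderiv ℝ φ) u v w = fderiv ℝ (fderiv ℝ φ) u w v :=
  (h.contDiffAt hu).isSymmSndFDerivAt (by
    rw [minSmoothness_of_isRCLikeNormedField]; exact WithTop.coe_le_coe.2 le_top) v w

theorem coneForm_fderiv (h : IsLocalParam b U φ) (hu : u ∈ U) (v : Fin n → ℝ) :
    coneForm b (φ u) (fderiv ℝ φ u v) = 0 := by
  obtain ⟨D, h1, hD⟩ :=
    exists_hasFDerivAt_bilinear (coneForm b) (h.hasFDerivAt hu) (h.hasFDerivAt hu)
  have h2 : HasFDerivAt (fun y => coneForm b (φ y) (φ y)) (0 : (Fin n → ℝ) →L[ℝ] ℝ) u := by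
    refine (hasFDerivAt_const (0 : ℝ) u).congr_of_eventuallyEq ?_
    filter_upwards [h.isOpen.mem_nhds hu] with y hy
    exact coneForm_self_eq_zero.2 (h.mem y hy)
  have h3 := DFunLike.congr_fun (h1.unique h2) v
  rw [hD, coneForm_comm b (fderiv ℝ φ u v), zero_apply] at h3
  linarith

/-- A covector that annihilates the tangent space of the cone is a multiple of its conormal. -/
theorem exists_eq_smul_coneForm (h : IsLocalParam b U φ) (hb : ∀ i, b i ≠ 0) (hu : u ∈ U)
    (L : HVec n →L[ℝ] ℝ) (h0 : L (φ u) = 0) (h1 : ∀ v, L (fderiv ℝ φ u v) = 0) :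
    ∃ l : ℝ, L = l • coneForm b (φ u) := by
  let A : (Fin n → ℝ) × ℝ →ₗ[ℝ] HVec n :=
    (fderiv ℝ φ u : (Fin n → ℝ) →ₗ[ℝ] HVec n).coprod (LinearMap.toSpanSingleton ℝ _ (φ u))
  have hA : ∀ v a, A (v, a) = fderiv ℝ φ u v + a • φ u := fun v a => by simp [A]
  have hinj : Function.Injective A := by
    rw [← LinearMap.ker_eq_bot, LinearMap.ker_eq_bot']
    rintro ⟨v, a⟩ hva
    rw [hA] at hva
    have hv : v = 0 := h.immersion u hu v (-a) (by rw [neg_smul]; exact eq_neg_of_add_eq_zero_left hva)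
    subst hv
    rw [map_zero, zero_add] at hva
    rw [(smul_eq_zero.1 hva).resolve_right (h.ne_zero u hu)]
    rfl
  let K : HVec n →ₗ[ℝ] ℝ := coneForm b (φ u)
  have hK : K ≠ 0 := by
    intro hK
    refine h.ne_zero u hu (coneForm_nondegenerate hb ?_)
    exact DFunLike.ext _ _ fun v => DFunLike.congr_fun hK v
  have hle : LinearMap.range A ≤ LinearMap.ker K := by
    rintro _ ⟨⟨v, a⟩, rfl⟩
    rw [LinearMap.mem_ker, hA]
    change coneForm b (φ u) _ = 0
    rw [map_add, map_smul, h.coneForm_fderiv hu, coneForm_self_eq_zero.2 (h.mem u hu)]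
    simp
  -- Both have dimension `n + 1`: the first by injectivity of `A`, the second as a hyperplane in
  -- `ℝ^{n+2}`.
  have hfr : Module.finrank ℝ (LinearMap.range A) = Module.finrank ℝ (LinearMap.ker K) := by
    rw [LinearMap.finrank_range_of_inj hinj]
    have h2 := K.finrank_range_add_finrank_ker
    rw [LinearMap.range_eq_top.2 (LinearMap.surjective hK), finrank_top] at h2
    simp only [Module.finrank_self, Module.finrank_prod, Module.finrank_fintype_fun_eq_card,
      Fintype.card_fin] at h2 ⊢
    omega
  have heq := Submodule.eq_of_le_of_finrank_eq hle hfr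
  have hLK : ⨅ _ : Unit, LinearMap.ker K ≤ LinearMap.ker (L : HVec n →ₗ[ℝ] ℝ) := by
    rw [iInf_const, ← heq]
    rintro _ ⟨⟨v, a⟩, rfl⟩
    rw [LinearMap.mem_ker, hA]
    change L _ = 0
    rw [map_add, map_smul, h0, h1]
    simp
  have hspan := mem_span_of_iInf_ker_le_ker (L := fun _ : Unit => K) hLK
  rw [Set.range_const, Submodule.mem_span_singleton] at hspan
  obtain ⟨l, hl⟩ := hspan
  exact ⟨l, DFunLike.ext _ _ fun v => (DFunLike.congr_fun hl v).symm⟩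

/-- For a null vector `v` of the metric, the covector of `Dφ v` annihilates the tangent space of the
cone, hence is a multiple of the conormal. Nondegeneracy of `coneForm` makes `Dφ v` a multiple of `φ
u`, contrary to the immersion condition. -/
theorem metricMatrix_det_ne_zero (h : IsLocalParam b U φ) (hb : ∀ i, b i ≠ 0) (hu : u ∈ U) :
    (metricMatrix b φ u).det ≠ 0 := by
  intro hdet
  obtain ⟨v, hv, hgv⟩ := Matrix.exists_mulVec_eq_zero_iff.2 hdet
  have hN := (denForm_pos hb (h.ne_zero u hu) (h.mem u hu)).ne'
  have hsingle : ∀ w : Fin n → ℝ, w = ∑ j, w j • Pi.single j (1 : ℝ) := fun w =>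
    pi_eq_sum_univ' w
  have key : ∀ m, coneForm b (fderiv ℝ φ u v) (fderiv ℝ φ u (Pi.single m 1)) = 0 := by
    intro m
    have h1 := congrFun hgv m
    simp only [Matrix.mulVec, dotProduct, metricMatrix, Matrix.of_apply, partialDeriv,
      quadricMetric_eq, Pi.zero_apply] at h1
    rw [hsingle v]
    rw [coneForm_comm]
    simp only [map_sum, map_smul, smul_eq_mul]
    have h2 : ∑ j, v j * coneForm b (fderiv ℝ φ u (Pi.single m 1))
        (fderiv ℝ φ u (Pi.single j 1)) =
        denForm b (φ u) (φ u) * ∑ j, coneForm b (fderiv ℝ φ u (Pi.single m 1))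
        (fderiv ℝ φ u (Pi.single j 1)) / denForm b (φ u) (φ u) * v j := by
      rw [Finset.mul_sum]
      exact Finset.sum_congr rfl fun j _ => by field_simp
    rw [h2, h1, mul_zero]
  obtain ⟨l, hl⟩ := h.exists_eq_smul_coneForm hb hu (coneForm b (fderiv ℝ φ u v))
    (by rw [coneForm_comm]; exact h.coneForm_fderiv hu v) (fun w => by
      rw [hsingle w]
      simp [key])
  have h3 : fderiv ℝ φ u v = l • φ u := by
    rw [← sub_eq_zero]
    refine coneForm_nondegenerate hb ?_
    rw [map_sub, map_smul, hl, sub_self]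
  exact hv (h.immersion u hu v l h3)

/-- The partial derivatives of the entries of the metric. -/
theorem partialDeriv_metricMatrix (h : IsLocalParam b U φ) (hb : ∀ i, b i ≠ 0) (hu : u ∈ U)
    (m j k : Fin n) :
    partialDeriv m (fun y => metricMatrix b φ y j k) u =
      (coneForm b (partialDeriv j φ u)
          (fderiv ℝ (fderiv ℝ φ) u (Pi.single m 1) (Pi.single k 1)) +
        coneForm b (fderiv ℝ (fderiv ℝ φ) u (Pi.single m 1) (Pi.single j 1))
          (partialDeriv k φ u)) / denForm b (φ u) (φ u) -
      coneForm b (partialDeriv j φ u) (partialDeriv k φ u) *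
        (2 * denForm b (φ u) (partialDeriv m φ u)) / denForm b (φ u) (φ u) ^ 2 := by
  have hN := (denForm_pos hb (h.ne_zero u hu) (h.mem u hu)).ne'
  have hd : ∀ v, HasFDerivAt (fun y => fderiv ℝ φ y v)
      ((fderiv ℝ (fderiv ℝ φ) u).flip v) u := fun v => by
    have := (h.hasFDerivAt_fderiv hu).clm_apply (hasFDerivAt_const v u)
    simpa using this
  obtain ⟨DQ, hQ, hDQ⟩ :=
    exists_hasFDerivAt_bilinear (coneForm b) (hd (Pi.single j 1)) (hd (Pi.single k 1))
  obtain ⟨DM, hM, hDM⟩ :=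
    exists_hasFDerivAt_bilinear (denForm b) (h.hasFDerivAt hu) (h.hasFDerivAt hu)
  have hg := hQ.fun_mul ((hasDerivAt_inv hN).comp_hasFDerivAt u hM)
  have e : (fun y => metricMatrix b φ y j k) = fun y =>
      coneForm b (fderiv ℝ φ y (Pi.single j 1)) (fderiv ℝ φ y (Pi.single k 1)) *
        ((fun x => x⁻¹) ∘ fun y => denForm b (φ y) (φ y)) y := by
    ext y
    simp only [metricMatrix, Matrix.of_apply, partialDeriv, quadricMetric_eq, div_eq_mul_inv,
      Function.comp]
  rw [partialDeriv, e, hg.fderiv]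
  simp only [partialDeriv, add_apply, smul_apply, smul_eq_mul, hDQ, hDM, Function.comp,
    ContinuousLinearMap.flip_apply]
  rw [denForm_comm b (fderiv ℝ φ u (Pi.single m 1))]
  field_simp
  ring

end IsLocalParam

/-- This turns the double sums over Christoffel symbols into coordinate-free expressions in the
velocity. -/
theorem bilinear_self_eq_sum {f : (Fin n → ℝ) → (Fin n → ℝ) → ℝ}
    (h1 : ∀ x x' y, f (x + x') y = f x y + f x' y) (h2 : ∀ (a : ℝ) x y, f (a • x) y = a * f x y)
    (h3 : ∀ x y y', f x (y + y') = f x y + f x y') (h4 : ∀ (a : ℝ) x y, f x (a • y) = a * f x y)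
    (w : Fin n → ℝ) :
    f w w = ∑ j, ∑ k, f (Pi.single j 1) (Pi.single k 1) * w j * w k := by
  let T := LinearMap.mk₂ ℝ f h1 h2 h3 h4
  change T w w = ∑ j, ∑ k, T (Pi.single j 1) (Pi.single k 1) * w j * w k
  conv_lhs => rw [pi_eq_sum_univ' w]
  simp only [map_sum, map_smul, LinearMap.sum_apply, LinearMap.smul_apply, smul_eq_mul,
    Finset.mul_sum]
  rw [Finset.sum_comm]
  exact Finset.sum_congr rfl fun _ _ => Finset.sum_congr rfl fun _ _ => by ring

/-- Lowering the index cancels `g⁻¹` and leaves the Christoffel symbols of the first kind. -/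
theorem mulVec_christoffel {g : (Fin n → ℝ) → Matrix (Fin n) (Fin n) ℝ} {u : Fin n → ℝ}
    (hg : (g u).det ≠ 0) (w : Fin n → ℝ) (m : Fin n) :
    (g u).mulVec (fun i => -∑ j, ∑ k, christoffel g u i j k * w j * w k) m =
      -∑ j, ∑ k, 1 / 2 * (partialDeriv j (fun y => g y m k) u +
        partialDeriv k (fun y => g y m j) u - partialDeriv m (fun y => g y j k) u) *
          w j * w k := by
  have e : (fun i => -∑ j, ∑ k, christoffel g u i j k * w j * w k) =
      -(g u)⁻¹.mulVec fun m => ∑ j, ∑ k, 1 / 2 * (partialDeriv j (fun y => g y m k) u +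
        partialDeriv k (fun y => g y m j) u - partialDeriv m (fun y => g y j k) u) *
          w j * w k := by
    ext i
    simp only [Pi.neg_apply, Matrix.mulVec, dotProduct, christoffel]
    congr 1
    simp only [Finset.mul_sum, Finset.sum_mul]
    conv_rhs => rw [Finset.sum_comm]
    refine Finset.sum_congr rfl fun _ _ => ?_
    conv_rhs => rw [Finset.sum_comm]
    exact Finset.sum_congr rfl fun _ _ => Finset.sum_congr rfl fun _ _ => by ring
  rw [e, Matrix.mulVec_neg, Matrix.mulVec_mulVec, Matrix.mul_nonsing_inv _ hg.isUnit,
    Matrix.one_mulVec]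
  rfl

namespace IsLocalParam

variable {b : Vec n} {U : Set (Fin n → ℝ)} {φ : (Fin n → ℝ) → HVec n} {u : Fin n → ℝ}

/-- The equation of geodesics as an equation for the lift `φ ∘ u` of the curve. -/
theorem geodesic_covector (h : IsLocalParam b U φ) (hb : ∀ i, b i ≠ 0) (hu : u ∈ U)
    {w a : Fin n → ℝ}
    (ha : a = fun i => -∑ j, ∑ k, christoffel (metricMatrix b φ) u i j k * w j * w k) :
    ∃ l : ℝ, coneForm b (fderiv ℝ (fderiv ℝ φ) u w w + fderiv ℝ φ u a) -
        (2 * denForm b (φ u) (fderiv ℝ φ u w) / denForm b (φ u) (φ u)) •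
          coneForm b (fderiv ℝ φ u w) +
        (coneForm b (fderiv ℝ φ u w) (fderiv ℝ φ u w) / denForm b (φ u) (φ u)) •
          denForm b (φ u) = l • coneForm b (φ u) := by
  have hN := (denForm_pos hb (h.ne_zero u hu) (h.mem u hu)).ne'
  set N := denForm b (φ u) (φ u) with hNdef
  set D := fderiv ℝ φ u with hD
  set H := fderiv ℝ (fderiv ℝ φ) u with hH
  have hsymm : ∀ x y, H x y = H y x := h.fderiv_symm hu
  have hzero : ∀ v, coneForm b (D v) (φ u) = 0 := fun v => by
    rw [coneForm_comm]; exact h.coneForm_fderiv hu v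
  refine h.exists_eq_smul_coneForm hb hu _ ?_ ?_
  -- Radial direction: differentiating `coneForm (φ, Dφ w) = 0` along `w` gives `coneForm (φ, H w w)
  -- = -coneForm (D w, D w)`, which the `denForm` term cancels.
  · have hd : HasFDerivAt (fun y => fderiv ℝ φ y w) (H.flip w) u := by
      have := (h.hasFDerivAt_fderiv hu).clm_apply (hasFDerivAt_const w u)
      simpa using this
    obtain ⟨D', h1, hD'⟩ := exists_hasFDerivAt_bilinear (coneForm b) (h.hasFDerivAt hu) hd
    have h2 : HasFDerivAt (fun y => coneForm b (φ y) (fderiv ℝ φ y w))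
        (0 : (Fin n → ℝ) →L[ℝ] ℝ) u := by
      refine (hasFDerivAt_const (0 : ℝ) u).congr_of_eventuallyEq ?_
      filter_upwards [h.isOpen.mem_nhds hu] with y hy
      exact h.coneForm_fderiv hy w
    have h3 := DFunLike.congr_fun (h1.unique h2) w
    rw [hD', ContinuousLinearMap.flip_apply, zero_apply, coneForm_comm] at h3
    simp only [add_apply, sub_apply, smul_apply, smul_eq_mul, map_add, hzero]
    rw [← hNdef]
    field_simp
    linear_combination N * h3
  -- Tangent directions: on the coordinate vectors this is the geodesic equation with its index
  -- lowered.
  · suffices hs : ∀ m : Fin n, coneForm b (H w w + D a) (D (Pi.single m 1)) -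
        (2 * denForm b (φ u) (D w) / N) * coneForm b (D w) (D (Pi.single m 1)) +
        (coneForm b (D w) (D w) / N) * denForm b (φ u) (D (Pi.single m 1)) = 0 by
      intro v
      rw [pi_eq_sum_univ' v]
      simp only [map_sum, map_smul, add_apply, sub_apply, smul_apply, smul_eq_mul] at hs ⊢
      exact Finset.sum_eq_zero fun m _ => by rw [hs m, mul_zero]
    intro m
    have h1 := mulVec_christoffel (h.metricMatrix_det_ne_zero hb hu) w m
    rw [← ha] at h1
    have h2 : (metricMatrix b φ u).mulVec a m = coneForm b (D a) (D (Pi.single m 1)) / N := by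
      rw [coneForm_comm]
      conv_rhs => rw [pi_eq_sum_univ' a]
      simp only [Matrix.mulVec, dotProduct, metricMatrix, Matrix.of_apply, partialDeriv,
        quadricMetric_eq, map_sum, map_smul, smul_eq_mul, Finset.sum_div]
      exact Finset.sum_congr rfl fun _ _ => by ring
    -- The function `f` is the Christoffel symbol of the first kind as a bilinear form; its `N ^ 2`
    -- terms come from differentiating `1 / N`.
    have h3 := bilinear_self_eq_sum (f := fun x y =>
      coneForm b (D (Pi.single m 1)) (H x y) / N -
        (coneForm b (D (Pi.single m 1)) (D y) * denForm b (φ u) (D x) +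
          coneForm b (D (Pi.single m 1)) (D x) * denForm b (φ u) (D y)) / N ^ 2 +
        coneForm b (D x) (D y) * denForm b (φ u) (D (Pi.single m 1)) / N ^ 2)
      (fun x x' y => by simp only [map_add, add_apply]; ring)
      (fun a x y => by simp only [map_smul, smul_apply, smul_eq_mul]; ring)
      (fun x y y' => by simp only [map_add]; ring)
      (fun a x y => by simp only [map_smul, smul_eq_mul]; ring) w
    have h4 : ∀ j k, 1 / 2 * (partialDeriv j (fun y => metricMatrix b φ y m k) u +
        partialDeriv k (fun y => metricMatrix b φ y m j) u -
        partialDeriv m (fun y => metricMatrix b φ y j k) u) =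
        coneForm b (D (Pi.single m 1)) (H (Pi.single j 1) (Pi.single k 1)) / N -
        (coneForm b (D (Pi.single m 1)) (D (Pi.single k 1)) * denForm b (φ u) (D (Pi.single j 1)) +
          coneForm b (D (Pi.single m 1)) (D (Pi.single j 1)) *
            denForm b (φ u) (D (Pi.single k 1))) / N ^ 2 +
        coneForm b (D (Pi.single j 1)) (D (Pi.single k 1)) *
          denForm b (φ u) (D (Pi.single m 1)) / N ^ 2 := by
      intro j k
      rw [h.partialDeriv_metricMatrix hb hu j m k, h.partialDeriv_metricMatrix hb hu k m j,
        h.partialDeriv_metricMatrix hb hu m j k]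
      simp only [partialDeriv]
      rw [← hNdef, ← hD, ← hH, hsymm (Pi.single k 1) (Pi.single j 1),
        hsymm (Pi.single m 1) (Pi.single j 1), hsymm (Pi.single m 1) (Pi.single k 1),
        coneForm_comm b (D (Pi.single j 1)) (H (Pi.single k 1) (Pi.single m 1)),
        coneForm_comm b (H (Pi.single j 1) (Pi.single m 1))]
      field_simp
      ring
    simp only [h4] at h1
    rw [h2, ← h3] at h1
    rw [map_add, add_apply, coneForm_comm b (H w w), coneForm_comm b (D w) (D (Pi.single m 1))]
    field_simp at h1 ⊢
    linear_combination h1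

end IsLocalParam

/-! ### Lifts of geodesics and conservation of the scalar square of the velocity. -/

/-- A geodesic has local lifts to the cone that satisfy a second order equation. -/
theorem IsGeodesic.exists_lift {b : Vec n} (hb : ∀ i, b i ≠ 0) {J : Set ℝ} {c : ℝ → quadric b}
    (h : IsGeodesic b J c) {t₀ : ℝ} (ht₀ : t₀ ∈ J) :
    ∃ ξ η ζ : ℝ → HVec n, ∀ᶠ t in 𝓝 t₀, Represents (c t : RPAmbient n) (ξ t) ∧
      HasDerivAt ξ (η t) t ∧ HasDerivAt η (ζ t) t ∧
      ∃ l : ℝ, coneForm b (ζ t) -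
        (2 * denForm b (ξ t) (η t) / denForm b (ξ t) (ξ t)) • coneForm b (η t) +
        (coneForm b (η t) (η t) / denForm b (ξ t) (ξ t)) • denForm b (ξ t) =
          l • coneForm b (ξ t) := by
  obtain ⟨U, φ, u, w, hφ, hev⟩ := h t₀ ht₀
  refine ⟨fun t => φ (u t), fun t => fderiv ℝ φ (u t) (w t), fun t =>
    fderiv ℝ (fderiv ℝ φ) (u t) (w t) (w t) + fderiv ℝ φ (u t)
      (fun i => -∑ j, ∑ k, christoffel (metricMatrix b φ) (u t) i j k * w t j * w t k), ?_⟩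
  filter_upwards [hev] with t ⟨hu, hr, hdu, hdw⟩
  refine ⟨hr, (hφ.hasFDerivAt hu).comp_hasDerivAt t hdu, ?_, hφ.geodesic_covector hb hu rfl⟩
  exact ((hφ.hasFDerivAt_fderiv hu).comp_hasDerivAt t hdu).clm_apply hdw

theorem hasDerivAt_bilinear {E : Type*} [NormedAddCommGroup E] [NormedSpace ℝ E]
    (B : E →L[ℝ] E →L[ℝ] ℝ) {f g : ℝ → E} {f' g' : E} {t : ℝ}
    (hf : HasDerivAt f f' t) (hg : HasDerivAt g g' t) :
    HasDerivAt (fun s => B (f s) (g s)) (B (f t) g' + B f' (g t)) t :=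
  B.hasDerivAt_of_bilinear (fun _ => hf) fun _ => hg

section Lift

variable {b : Vec n} {c : ℝ → quadric b} {ξ : ℝ → HVec n} {η : HVec n} {t : ℝ}

theorem coneForm_self_of_represents {P : quadric b} {ξ : HVec n}
    (h : Represents (P : RPAmbient n) ξ) : coneForm b ξ ξ = 0 :=
  coneForm_self_eq_zero.2 (P.2 ξ h)

theorem denForm_pos_of_represents (hb : ∀ i, b i ≠ 0) {P : quadric b} {ξ : HVec n}
    (h : Represents (P : RPAmbient n) ξ) : 0 < denForm b ξ ξ :=
  denForm_pos hb h.1 (P.2 ξ h)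

theorem coneForm_deriv_eq_zero (hr : ∀ᶠ s in 𝓝 t, Represents (c s : RPAmbient n) (ξ s))
    (hξ : HasDerivAt ξ η t) : coneForm b (ξ t) η = 0 := by
  have h1 := hasDerivAt_bilinear (coneForm b) hξ hξ
  have h2 : HasDerivAt (fun s => coneForm b (ξ s) (ξ s)) 0 t :=
    (hasDerivAt_const t (0 : ℝ)).congr_of_eventuallyEq <| by
      filter_upwards [hr] with s hs using coneForm_self_of_represents hs
  have h3 := h1.unique h2
  rw [coneForm_comm b η] at h3
  linarith

/-- The scalar square of the velocity does not depend on the lift. -/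
theorem HasSqSpeedAt.unique (hb : ∀ i, b i ≠ 0) {κ κ' : ℝ} (h : HasSqSpeedAt b c t κ)
    (h' : HasSqSpeedAt b c t κ') : κ = κ' := by
  obtain ⟨ξ, η, hr, hξ, rfl⟩ := h
  obtain ⟨ξ', η', hr', hξ', rfl⟩ := h'
  obtain ⟨i, hi⟩ := Function.ne_iff.1 (fst_ne_zero_of_mem hr.self_of_nhds.1
    ((c t).2 _ hr.self_of_nhds))
  have hi : (ξ t).1 i ≠ 0 := hi
  have hξi : HasDerivAt (fun s => (ξ s).1 i) (η.1 i) t := hasDerivAt_pi.1 hξ.fst i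
  have hξi' : HasDerivAt (fun s => (ξ' s).1 i) (η'.1 i) t := hasDerivAt_pi.1 hξ'.fst i
  have ha := hξi'.fun_div hξi hi
  -- Reading the ratio of the two lifts off a nonvanishing coordinate shows that it is
  -- differentiable.
  have hev : ∀ᶠ s in 𝓝 t, ξ' s = ((ξ' s).1 i / (ξ s).1 i) • ξ s := by
    filter_upwards [hr, hr', hξi.continuousAt.eventually_ne hi] with s hs hs' hsi
    obtain ⟨a, -, e⟩ := hs.exists_smul hs'
    rw [e]
    congr 1
    simp [hsi]
  have hη := hξ'.unique ((ha.smul hξ).congr_of_eventuallyEq hev)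
  set a' := (η'.1 i * (ξ t).1 i - (ξ' t).1 i * η.1 i) / (ξ t).1 i ^ 2
  set a := (ξ' t).1 i / (ξ t).1 i
  have hξt : ξ' t = a • ξ t := hev.self_of_nhds
  have ha0 : a ≠ 0 := by
    intro h0
    rw [h0, zero_smul] at hξt
    exact hr'.self_of_nhds.1 hξt
  have h0 := coneForm_self_of_represents hr.self_of_nhds
  have h1 := coneForm_deriv_eq_zero hr hξ
  have h1' : coneForm b η (ξ t) = 0 := by rw [coneForm_comm, h1]
  have hN := (denForm_pos_of_represents hb hr.self_of_nhds).ne'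
  -- The new velocity is `a η + a' ξ`. The terms with `a'` vanish because `ξ` is
  -- `coneForm`-orthogonal to itself and to `η`; the factor `a ^ 2` cancels against the denominator.
  rw [quadricMetric_eq, quadricMetric_eq, hξt, hη]
  simp only [map_add, map_smul, add_apply, smul_apply, smul_eq_mul, h0, h1, h1']
  field_simp
  ring

end Lift

/-- At the time `t`, the curve `ξ` is a lift to the cone of the curve `c` on the quadric, with the
velocity `η` and the acceleration `ζ`, that satisfies the equation of geodesics. -/
structure IsGeodesicLiftAt (b : Vec n) (c : ℝ → quadric b) (ξ η ζ : ℝ → HVec n) (t : ℝ) :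
    Prop where
  represents : Represents (c t : RPAmbient n) (ξ t)
  hasDerivAt : HasDerivAt ξ (η t) t
  hasDerivAt_velocity : HasDerivAt η (ζ t) t
  equation : ∃ l : ℝ, coneForm b (ζ t) -
    (2 * denForm b (ξ t) (η t) / denForm b (ξ t) (ξ t)) • coneForm b (η t) +
    (coneForm b (η t) (η t) / denForm b (ξ t) (ξ t)) • denForm b (ξ t) =
      l • coneForm b (ξ t)

section GeodesicLift

variable {b : Vec n} {c : ℝ → quadric b} {ξ η ζ : ℝ → HVec n} {t : ℝ}

/-- Evaluate the geodesic equation on the velocity: the right side vanishes by tangency to the cone,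
and the left side is the derivative of the quotient up to a nonzero factor. -/
theorem hasDerivAt_sqSpeed (hb : ∀ i, b i ≠ 0)
    (h : ∀ᶠ s in 𝓝 t, IsGeodesicLiftAt b c ξ η ζ s) :
    HasDerivAt (fun s => quadricMetric b (ξ s) (η s) (η s)) 0 t := by
  have ht := h.self_of_nhds
  have hN := (denForm_pos_of_represents hb ht.represents).ne'
  have hE := hasDerivAt_bilinear (coneForm b) ht.hasDerivAt_velocity ht.hasDerivAt_velocity
  have hM := hasDerivAt_bilinear (denForm b) ht.hasDerivAt ht.hasDerivAt
  have h0 := coneForm_deriv_eq_zero (h.mono fun s hs => hs.represents) ht.hasDerivAt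
  obtain ⟨l, hl⟩ := ht.equation
  have h1 := DFunLike.congr_fun hl (η t)
  simp only [add_apply, sub_apply, smul_apply, smul_eq_mul, h0, mul_zero] at h1
  have := hE.fun_div hM hN
  simp only [quadricMetric_eq]
  refine this.congr_deriv ?_
  rw [div_eq_zero_iff]
  left
  rw [coneForm_comm b (η t) (ζ t), denForm_comm b (η t) (ξ t)]
  field_simp at h1
  linear_combination 2 * h1

theorem exists_sqSpeed_of_lift (hb : ∀ i, b i ≠ 0)
    (h : ∀ᶠ s in 𝓝 t, IsGeodesicLiftAt b c ξ η ζ s) :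
    ∃ κ, ∀ᶠ s in 𝓝 t, quadricMetric b (ξ s) (η s) (η s) = κ := by
  obtain ⟨r, hr, hr'⟩ := Metric.eventually_nhds_iff_ball.1 h.eventually_nhds
  have hd : ∀ s ∈ Metric.ball t r,
      HasDerivAt (fun s => quadricMetric b (ξ s) (η s) (η s)) 0 s :=
    fun s hs => hasDerivAt_sqSpeed hb (hr' s hs)
  obtain ⟨κ, hκ⟩ := Metric.isOpen_ball.exists_is_const_of_deriv_eq_zero
    (convex_ball t r).isPreconnected
    (fun s hs => (hd s hs).differentiableAt.differentiableWithinAt)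
    (fun s hs => (hd s hs).deriv)
  exact ⟨κ, Filter.mem_of_superset (Metric.ball_mem_nhds t hr) hκ⟩

theorem hasSqSpeedAt_of_lift (h : ∀ᶠ s in 𝓝 t, IsGeodesicLiftAt b c ξ η ζ s) :
    HasSqSpeedAt b c t (quadricMetric b (ξ t) (η t) (η t)) :=
  ⟨ξ, η t, h.mono fun _ hs => hs.represents, h.self_of_nhds.hasDerivAt, rfl⟩

theorem IsGeodesic.exists_geodesicLift (hb : ∀ i, b i ≠ 0) {J : Set ℝ} (h : IsGeodesic b J c)
    (ht : t ∈ J) : ∃ ξ η ζ, ∀ᶠ s in 𝓝 t, IsGeodesicLiftAt b c ξ η ζ s := by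
  obtain ⟨ξ, η, ζ, hev⟩ := h.exists_lift hb ht
  exact ⟨ξ, η, ζ, hev.mono fun s hs => ⟨hs.1, hs.2.1, hs.2.2.1, hs.2.2.2⟩⟩

/-- The scalar square of the velocity of a geodesic is constant. -/
theorem IsGeodesic.hasSqSpeedAt (hb : ∀ i, b i ≠ 0) {J : Set ℝ} (hJ : IsPreconnected J)
    (h : IsGeodesic b J c) {κ : ℝ} {t₀ : ℝ} (ht₀ : t₀ ∈ J) (hκ : HasSqSpeedAt b c t₀ κ) :
    ∀ t ∈ J, HasSqSpeedAt b c t κ := by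
  intro t ht
  refine (hJ.induction₂ (fun x y => HasSqSpeedAt b c x κ ↔ HasSqSpeedAt b c y κ) ?_
    (fun _ _ _ _ _ _ h1 h2 => h1.trans h2) (fun _ _ _ _ h1 => h1.symm) ht₀ ht).1 hκ
  intro x hx
  obtain ⟨ξ, η, ζ, hev⟩ := h.exists_geodesicLift hb hx
  obtain ⟨κ', hκ'⟩ := exists_sqSpeed_of_lift hb hev
  refine mem_nhdsWithin_of_mem_nhds ?_
  filter_upwards [hev.eventually_nhds, hκ'] with y hy hy'
  have h1 := hasSqSpeedAt_of_lift hev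
  have h2 := hasSqSpeedAt_of_lift hy
  rw [hκ'.self_of_nhds] at h1
  rw [hy'] at h2
  exact ⟨fun h => h1.unique hb h ▸ h2, fun h => h2.unique hb h ▸ h1⟩

end GeodesicLift

/-! ### From lifted geodesics to the Neumann system. -/

theorem HasDerivAt.mulB (b : Vec n) {x : ℝ → Vec n} {x' : Vec n} {t : ℝ}
    (h : HasDerivAt x x' t) : HasDerivAt (fun s => mulB b (x s)) (Knorrer.mulB b x') t :=
  hasDerivAt_pi.2 fun i => (hasDerivAt_pi.1 h i).const_mul (b i)

theorem formB_inv_mulB {b : Vec n} (hb : ∀ i, b i ≠ 0) (x y : Vec n) :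
    formB b⁻¹ (mulB b x) (mulB b y) = formB b x y := by
  refine Finset.sum_congr rfl fun i _ => ?_
  have := hb i
  simp only [mulB, Pi.inv_apply]
  field_simp

theorem sum_mul_eq_zero_of_normSq {q p : ℝ → Vec n} {t : ℝ}
    (h1 : ∀ᶠ s in 𝓝 t, normSq (q s) = 1) (hq : HasDerivAt q (p t) t) :
    ∑ i, q t i * p t i = 0 := by
  have h2 : HasDerivAt (fun s => normSq (q s)) (∑ i, 2 * q t i * p t i) t := by
    refine HasDerivAt.fun_sum fun i _ => ?_
    simpa using (hasDerivAt_pi.1 hq i).fun_pow 2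
  have h3 : HasDerivAt (fun s => normSq (q s)) 0 t :=
    (hasDerivAt_const t (1 : ℝ)).congr_of_eventuallyEq h1
  have h4 := h2.unique h3
  simp only [mul_assoc, ← Finset.mul_sum] at h4
  linarith

/-- The Lagrange multiplier of a constrained motion on the sphere. -/
theorem multiplier_eq {b : Vec n} {κ μ : ℝ} {q p : ℝ → Vec n} {t : ℝ}
    (h1 : ∀ᶠ s in 𝓝 t, normSq (q s) = 1) (hq : ∀ᶠ s in 𝓝 t, HasDerivAt q (p s) s)
    (hp : HasDerivAt p (-(κ • mulB b (q t)) + μ • q t) t) :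
    μ = κ * formB b (q t) (q t) - normSq (p t) := by
  have h2 : HasDerivAt (fun s => ∑ i, q s i * p s i)
      (∑ i, (p t i * p t i + q t i * (-(κ • mulB b (q t)) + μ • q t) i)) t :=
    HasDerivAt.fun_sum fun i _ =>
      (hasDerivAt_pi.1 hq.self_of_nhds i).fun_mul (hasDerivAt_pi.1 hp i)
  have h3 : HasDerivAt (fun s => ∑ i, q s i * p s i) 0 t :=
    (hasDerivAt_const t (0 : ℝ)).congr_of_eventuallyEq <| by
      filter_upwards [h1.eventually_nhds, hq] with s hs hs' using sum_mul_eq_zero_of_normSq hs hs'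
  have h4 := h2.unique h3
  have h5 : ∑ i, (p t i * p t i + q t i * (-(κ • mulB b (q t)) + μ • q t) i) =
      normSq (p t) - κ * formB b (q t) (q t) + μ * normSq (q t) := by
    simp only [normSq, formB, mulB, Finset.mul_sum, ← Finset.sum_sub_distrib,
      ← Finset.sum_add_distrib, Pi.add_apply, Pi.neg_apply, Pi.smul_apply, smul_eq_mul]
    exact Finset.sum_congr rfl fun _ _ => by ring
  rw [h5, h1.self_of_nhds] at h4
  linarith

/-- At the time `t`, the curve `q` on the unit sphere is a lift of the curve `R` in `ℝPⁿ`, solves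
the equation `q̈ = -κ B q + μ q` and has the constant of motion of a Knörrer image. -/
structure IsNeumannLiftAt (b : Vec n) (κ : ℝ) (R : ℝ → RP n) (q : ℝ → Vec n) (t : ℝ) : Prop where
  represents : Represents (R t) (q t)
  normSq_eq : normSq (q t) = 1
  hasDerivAt : HasDerivAt q (deriv q t) t
  hasDerivAt_deriv : HasDerivAt (deriv q) (-(κ • mulB b (q t)) +
    (κ * formB b (q t) (q t) - normSq (deriv q t)) • q t) t
  constant : (formB b⁻¹ (deriv q t) (deriv q t) - κ) * formB b⁻¹ (q t) (q t) =
    formB b⁻¹ (deriv q t) (q t) ^ 2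

namespace IsNeumannLiftAt

variable {b : Vec n} {κ : ℝ} {R : ℝ → RP n} {q q' : ℝ → Vec n} {t : ℝ}

/-- With `deriv q` as momentum the condition depends only on the germ of `q`. This lemma, `neg` and
`eq_or_eq_neg` are what `exists_global_of_local` needs for gluing. -/
theorem congr (h : IsNeumannLiftAt b κ R q t) (e : q =ᶠ[𝓝 t] q') :
    IsNeumannLiftAt b κ R q' t := by
  have e0 := e.eq_of_nhds
  have e1 := e.deriv
  have e1' := e1.eq_of_nhds
  refine ⟨e0 ▸ h.1, e0 ▸ h.2, ?_, ?_, ?_⟩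
  · rw [← e1']; exact h.3.congr_of_eventuallyEq e.symm
  · rw [← e1', ← e0]; exact h.4.congr_of_eventuallyEq e1.symm
  · rw [← e1', ← e0]; exact h.5

theorem neg (h : IsNeumannLiftAt b κ R q t) : IsNeumannLiftAt b κ R (-q) t := by
  have e1 : deriv (-q) = -deriv q := by ext1 s; exact deriv.neg
  have hB : ∀ d x y : Vec n, formB d (-x) (-y) = formB d x y := fun d x y => by simp [formB]
  have hn : ∀ x : Vec n, normSq (-x) = normSq x := fun x => by simp [normSq]
  have hm : ∀ x : Vec n, mulB b (-x) = -mulB b x := fun x => by ext; simp [mulB]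
  refine ⟨?_, ?_, ?_, ?_, ?_⟩
  · simpa using h.1.smul (a := -1) (by norm_num)
  · rw [Pi.neg_apply, hn, h.2]
  · rw [e1]; exact h.3.neg
  · rw [e1]
    refine h.4.neg.congr_deriv ?_
    simp only [Pi.neg_apply, hB, hn, hm]
    module
  · simp only [e1, Pi.neg_apply, hB, h.5]

theorem eq_or_eq_neg (h : IsNeumannLiftAt b κ R q t) (h' : IsNeumannLiftAt b κ R q' t) :
    q' t = q t ∨ q' t = -q t := by
  obtain ⟨a, -, e⟩ := h.1.exists_smul h'.1
  have h2 := h'.2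
  rw [e, normSq_smul, h.2, mul_one, sq_eq_one_iff] at h2
  rcases h2 with rfl | rfl
  · left; simpa using e
  · right; simpa using e

end IsNeumannLiftAt

/-- The normalized image `B x / |B x|` of a lifted geodesic. -/
theorem IsGeodesicLiftAt.isNeumannLiftAt {b : Vec n} (hb : ∀ i, b i ≠ 0) {c : ℝ → quadric b}
    {ξ η ζ : ℝ → HVec n} {κ t : ℝ}
    (h : ∀ᶠ s in 𝓝 t, IsGeodesicLiftAt b c ξ η ζ s)
    (hκ : quadricMetric b (ξ t) (η t) (η t) = κ) :
    IsNeumannLiftAt b κ (fun s => knorrerMap b hb (c s))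
      (fun s => (Real.sqrt (denForm b (ξ s) (ξ s)))⁻¹ • mulB b (ξ s).1) t := by
  set ρ : ℝ → ℝ := fun s => (Real.sqrt (denForm b (ξ s) (ξ s)))⁻¹ with hρ
  set m : ℝ → ℝ := fun s => denForm b (ξ s) (η s) with hm
  set q : ℝ → Vec n := fun s => ρ s • mulB b (ξ s).1 with hq
  set p : ℝ → Vec n := fun s => ρ s • mulB b (η s).1 - (ρ s ^ 3 * m s) • mulB b (ξ s).1 with hp
  have hNpos : ∀ s, IsGeodesicLiftAt b c ξ η ζ s → 0 < denForm b (ξ s) (ξ s) :=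
    fun s hs => denForm_pos_of_represents hb hs.represents
  have hρpos : ∀ s, IsGeodesicLiftAt b c ξ η ζ s → 0 < ρ s :=
    fun s hs => inv_pos.2 (Real.sqrt_pos.2 (hNpos s hs))
  have hρN : ∀ s, IsGeodesicLiftAt b c ξ η ζ s → ρ s ^ 2 * denForm b (ξ s) (ξ s) = 1 := by
    intro s hs
    rw [hρ]
    simp only [inv_pow, Real.sq_sqrt (hNpos s hs).le]
    exact inv_mul_cancel₀ (hNpos s hs).ne'
  have hdρ : ∀ s, IsGeodesicLiftAt b c ξ η ζ s → HasDerivAt ρ (-(ρ s ^ 3 * m s)) s := by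
    intro s hs
    have h1 := hasDerivAt_bilinear (denForm b) hs.hasDerivAt hs.hasDerivAt
    have h2 := (h1.sqrt (hNpos s hs).ne').fun_inv (Real.sqrt_pos.2 (hNpos s hs)).ne'
    refine h2.congr_deriv ?_
    have h3 := (Real.sqrt_pos.2 (hNpos s hs)).ne'
    rw [hρ, hm, denForm_comm b (η s)]
    field_simp
    ring
  have hdq : ∀ s, IsGeodesicLiftAt b c ξ η ζ s → HasDerivAt q (p s) s := by
    intro s hs
    refine ((hdρ s hs).fun_smul (HasDerivAt.mulB b hs.hasDerivAt.fst)).congr_deriv ?_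
    rw [hp]
    module
  have hdq' : ∀ᶠ s in 𝓝 t, HasDerivAt q (p s) s := h.mono hdq
  have hqd : deriv q =ᶠ[𝓝 t] p := hdq'.mono fun s hs => hs.deriv
  have hqn : ∀ᶠ s in 𝓝 t, normSq (q s) = 1 := by
    filter_upwards [h] with s hs
    rw [hq, normSq_smul, ← denForm_self, hρN s hs]
  have ht := h.self_of_nhds
  have hρt := (hρpos t ht).ne'
  have hρNt := hρN t ht
  have hNt := (hNpos t ht).ne'
  have hNinv : (denForm b (ξ t) (ξ t))⁻¹ = ρ t ^ 2 :=
    inv_eq_of_mul_eq_one_left hρNt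
  -- The value of `d` is irrelevant: it only multiplies `B ξ'` and is absorbed into the multiplier.
  obtain ⟨d, hd⟩ : ∃ d, HasDerivAt (fun s => ρ s ^ 3 * m s) d t :=
    ⟨_, ((hdρ t ht).fun_pow 3).fun_mul
      (hasDerivAt_bilinear (denForm b) ht.hasDerivAt ht.hasDerivAt_velocity)⟩
  have hdp := ((hdρ t ht).fun_smul (HasDerivAt.mulB b ht.hasDerivAt_velocity.fst)).fun_sub
    (hd.fun_smul (HasDerivAt.mulB b ht.hasDerivAt.fst))
  obtain ⟨l, hl⟩ := ht.equation
  rw [← quadricMetric_eq, hκ, div_eq_mul_inv, hNinv] at hl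
  have hcoord : ∀ i, b i * (ζ t).1 i =
      2 * m t * ρ t ^ 2 * (b i * (η t).1 i) - κ * (b i ^ 2 * (ξ t).1 i) +
        l * (b i * (ξ t).1 i) := by
    intro i
    have h1 := DFunLike.congr_fun hl ((Pi.single i 1, 0) : HVec n)
    simp only [add_apply, sub_apply, smul_apply, smul_eq_mul, coneForm_apply, denForm_apply,
      formB_single, mul_zero, sub_zero] at h1
    rw [hm]
    simp only [denForm_apply]
    linear_combination h1
  -- The two contributions `-ρ³ m B η'` cancel the velocity term `2 ρ³ m B η'` of `ρ B ζ'`.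
  have hdp' : HasDerivAt p (-(κ • mulB b (q t)) + (l - d / ρ t) • q t) t := by
    refine hdp.congr_deriv ?_
    ext i
    simp only [hq, mulB, Pi.add_apply, Pi.sub_apply, Pi.neg_apply, Pi.smul_apply, smul_eq_mul,
      hcoord i]
    field_simp
    ring
  have hμ := multiplier_eq hqn hdq' hdp'
  refine ⟨?_, hqn.self_of_nhds, ?_, ?_, ?_⟩
  · exact (knorrerMap_represents hb (c t) ht.represents).smul hρt
  · rw [hqd.eq_of_nhds]; exact hdq t ht
  · rw [hqd.eq_of_nhds, ← hμ]; exact hdp'.congr_of_eventuallyEq hqd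
  · rw [hqd.eq_of_nhds]
    have hp' : p t = ρ t • mulB b (η t).1 + (-(ρ t ^ 3 * m t)) • mulB b (ξ t).1 := by
      rw [hp]; module
    have e1 := coneForm_self_of_represents ht.represents
    have e2 := coneForm_deriv_eq_zero (h.mono fun s hs => hs.represents) ht.hasDerivAt
    have e3 : coneForm b (η t) (η t) * ρ t ^ 2 = κ := by
      rw [← hNinv, ← hκ, quadricMetric_eq, div_eq_mul_inv]
    rw [coneForm_apply] at e1 e2 e3
    have e1 : formB b (ξ t).1 (ξ t).1 = (ξ t).2 * (ξ t).2 := by linarith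
    have e2 : formB b (ξ t).1 (η t).1 = (ξ t).2 * (η t).2 := by linarith
    rw [hp', hq]
    simp only [formB_add_left, formB_add_right, formB_smul_left, formB_smul_right,
      formB_inv_mulB hb, e1, e2, formB_comm b (η t).1 (ξ t).1]
    -- After the substitutions only `coneForm (η, η) ρ² = κ` remains, multiplied by `(B⁻¹q, q) = ρ²
    -- ξₙ₊₁²`.
    linear_combination (ρ t ^ 2 * (ξ t).2 ^ 2) * e3

theorem IsGeodesic.exists_neumannLift {b : Vec n} (hb : ∀ i, b i ≠ 0) {J : Set ℝ}
    (hJ : IsPreconnected J) {c : ℝ → quadric b} (h : IsGeodesic b J c) {κ : ℝ}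
    (hκ : ∀ t ∈ J, HasSqSpeedAt b c t κ) :
    ∃ q, ∀ t ∈ J, IsNeumannLiftAt b κ (fun s => knorrerMap b hb (c s)) q t := by
  refine exists_global_of_local hJ _ (fun f g t e hf => hf.congr e) (fun f t hf => hf.neg)
    (fun f t hf => hf.hasDerivAt.continuousAt) (fun f t hf => hf.represents.1)
    (fun f g t hf hg => hf.eq_or_eq_neg hg) fun t ht => ?_
  obtain ⟨ξ, η, ζ, hev⟩ := h.exists_geodesicLift hb ht
  obtain ⟨κ', hκ'⟩ := exists_sqSpeed_of_lift hb hev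
  have e : κ' = κ := by
    rw [← hκ'.self_of_nhds]
    exact (hasSqSpeedAt_of_lift hev).unique hb (hκ t ht)
  subst e
  refine ⟨fun s => (Real.sqrt (denForm b (ξ s) (ξ s)))⁻¹ • mulB b (ξ s).1, ?_⟩
  filter_upwards [hev.eventually_nhds, hκ'] with s hs hs'
  exact IsGeodesicLiftAt.isNeumannLiftAt hb hs hs'

/-- The passage to the natural parameter. -/
theorem exists_neumannSolution {b : Vec n} {J : Set ℝ} {R : ℝ → RP n} {q : ℝ → Vec n}
    {ε k : ℝ} (hε : ε = 1 ∨ ε = -1) (hk : 0 < k)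
    (h : ∀ t ∈ J, IsNeumannLiftAt b (ε * k ^ 2) R q t) :
    ∃ Q P : ℝ → Vec n, IsNeumannSolution b ε ((fun t => k * t) '' J) Q P ∧
      ∀ τ ∈ (fun t => k * t) '' J, Represents (R (τ / k)) (Q τ) ∧ Psi b ε 0 (P τ) (Q τ) = 0 := by
  have hk0 := hk.ne'
  have hτ : ∀ t, k * t / k = t := fun t => mul_div_cancel_left₀ t hk0
  have hε2 : ε * ε = 1 := by rcases hε with rfl | rfl <;> norm_num
  have hs : ∀ t, HasDerivAt (fun τ => τ / k) k⁻¹ (k * t) := fun t => by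
    simpa using (hasDerivAt_id (k * t)).div_const k
  -- Each derivative in `τ` contributes a factor `1 / k`, so `κ = ε k²` becomes `ε`.
  refine ⟨fun τ => q (τ / k), fun τ => k⁻¹ • deriv q (τ / k), ?_, ?_⟩
  · rintro _ ⟨t, ht, rfl⟩
    have ht := h t ht
    have h3 := ht.3
    have h4 := ht.4
    rw [← hτ t] at h3 h4
    have h3 := HasDerivAt.scomp (k * t) h3 (hs t)
    have h4 := (HasDerivAt.scomp (k * t) h4 (hs t)).const_smul k⁻¹
    refine ⟨?_, h3, ?_⟩
    · simp only [hτ]; exact ht.2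
    · refine h4.congr_deriv ?_
      simp only [hτ, normSq_smul]
      ext i
      simp only [Pi.add_apply, Pi.neg_apply, Pi.smul_apply, smul_eq_mul]
      field_simp
  · rintro _ ⟨t, ht, rfl⟩
    have ht := h t ht
    simp only [hτ]
    refine ⟨ht.1, ?_⟩
    -- Since `ε² = 1`, the resolvent at `u = 0` is `-ε B⁻¹`.
    have hS : ∀ x y : Vec n, ∑ i, (0 - ε * b i)⁻¹ * x i * y i = -ε * formB b⁻¹ x y := by
      intro x y
      rw [formB, Finset.mul_sum]
      refine Finset.sum_congr rfl fun i _ => ?_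
      rw [zero_sub, inv_neg, mul_inv, inv_eq_of_mul_eq_one_left hε2, Pi.inv_apply]
      ring
    have h5 := ht.5
    rw [Psi, hS, hS, hS]
    simp only [formB_smul_left, formB_smul_right]
    rcases hε with rfl | rfl
    · field_simp
      linear_combination h5
    · field_simp
      linear_combination h5

end

end Knorrer

theorem theorem9p6 (n : ℕ) (b : Knorrer.Vec n) (hmono : StrictMono b) (hneg : b 0 < 0)
    (hpos : ∀ i, i ≠ 0 → 0 < b i) :
    (∃! ν : Knorrer.quadric b → Knorrer.RP n, Knorrer.IsKnorrerMap b ν) ∧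
    ∀ ν : Knorrer.quadric b → Knorrer.RP n, Knorrer.IsKnorrerMap b ν →
      ∀ (J : Set ℝ) (c : ℝ → Knorrer.quadric b), IsOpen J → IsPreconnected J →
        Knorrer.IsGeodesic b J c → Knorrer.IsNonIsotropic b J c →
        ∃ ε k : ℝ, (ε = 1 ∨ ε = -1) ∧ 0 < k ∧
          (∀ t ∈ J, Knorrer.HasSqSpeedAt b c t (ε * k ^ 2)) ∧
          ∃ q p : ℝ → Knorrer.Vec n,
            Knorrer.IsNeumannSolution b ε ((fun t => k * t) '' J) q p ∧
            ∀ τ ∈ (fun t => k * t) '' J,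
              Knorrer.Represents (ν (c (τ / k))) (q τ) ∧
              Knorrer.Psi b ε 0 (p τ) (q τ) = 0 := by
  have hb : ∀ i, b i ≠ 0 := fun i => by
    by_cases hi : i = 0
    · exact hi ▸ hneg.ne
    · exact (hpos i hi).ne'
  refine ⟨⟨_, Knorrer.isKnorrerMap_knorrerMap hb, fun ν hν =>
    hν.eq hneg hpos (Knorrer.isKnorrerMap_knorrerMap hb)⟩, ?_⟩
  rintro ν hν J c - hJ hgeo ⟨t₀, ht₀, κ, hκ0, hκ⟩
  -- By uniqueness `ν` may be taken to be the explicit map.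
  obtain rfl := hν.eq hneg hpos (Knorrer.isKnorrerMap_knorrerMap hb)
  obtain ⟨ε, k, hε, hk, rfl⟩ : ∃ ε k : ℝ, (ε = 1 ∨ ε = -1) ∧ 0 < k ∧ κ = ε * k ^ 2 := by
    rcases hκ0.lt_or_gt with h | h
    · exact ⟨-1, Real.sqrt (-κ), Or.inr rfl, Real.sqrt_pos.2 (neg_pos.2 h), by
        rw [Real.sq_sqrt (neg_pos.2 h).le]; ring⟩
    · exact ⟨1, Real.sqrt κ, Or.inl rfl, Real.sqrt_pos.2 h, by rw [Real.sq_sqrt h.le]; ring⟩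
  have hspeed := hgeo.hasSqSpeedAt hb hJ ht₀ hκ
  obtain ⟨q, hq⟩ := hgeo.exists_neumannLift hb hJ hspeed
  exact ⟨ε, k, hε, hk, hspeed, Knorrer.exists_neumannSolution hε hk hq⟩
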